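/- **Theorem 4.2.** Let $\omega,\epsilon,\mu,c_0>0$, $k=\omega\sqrt{\epsilon\mu}$, $g(x,y)=\frac{e^{ik|x-y|}}{4\pi|x-y|}$. Let $\Omega\subset\mathbb R^3$ be a bounded open set, and let $h:\Omega\to\mathbb C$ with $\operatorname{Re}h\ge 0$ and $N:\Omega\to[0,\infty)$ be continuous. Let $D$ be a particle, i.e. a bounded open set with $C^2$ boundary $S$ of finite positive area $|S|$ and outward unit normal $\nu$, and let $\tau_{jp}=\delta_{jp}-\frac1{|S|}\int_S\nu_j\nu_p\,dS$ be its tensor. Assume that $\tau$ is a multiple of the unit tensor $I$, and that $$d(x):=1+\frac{2c_0}{3i\omega\mu}h(x)N(x)\neq 0\quad\text{for all }x\in\Omega .$$ The limiting medium in $\Omega$, obtained by embedding many small particles with tensor $\tau$ and surface areas $c_0a^2$ ($a\to0$) in a medium with constant permittivity $\epsilon$ and permeability $\mu$, is the medium whose fields satisfy the limiting integral equation $$E(x)=E_0(x)-\frac{c_0}{i\omega\mu}\nabla\times\int_\Omega g(x,y)h(y)N(y)\,\tau\,\nabla\times E(y)\,dy,\qquad x\in\Omega, \tag{1}$$ where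 $E_0(x)=\mathcal E e^{ik\alpha\cdot x}$, $\mathcal E\in\mathbb C^3$, $\alpha\in S^2$, $\mathcal E\cdot\alpha=0$. A solution of (1) means $E\in C^1(\Omega;\mathbb C^3)$ such that $hN\tau\,\nabla\times E$ is integrable on $\Omega$, the integral in (1) is of class $C^1$ in $\Omega$, and (1) holds. Then: 1. $\tau=\frac23 I$; moreover every ball is a particle with $\tau=\frac23I$. 2. The limiting medium has the permittivity $\epsilon$, the magnetic permeability $$\mu(x)=\frac{\mu}{1+\frac{2c_0}{3i\omega\mu}h(x)N(x)}$$ and the refraction coefficient $$n(x)=\frac1{\sqrt{1+\frac{2c_0}{3i\omega\mu}h(x)N(x)}}$$ (with any choice of the square root), in the following sense. One has $k^2n^2(x)=\omega^2\epsilon\mu(x)$ in $\Omega$, and for all $\alpha,\mathcal E$ as above and every solution $E$ of (1) there is a continuous field $H$ in $\Omega$ such that $$\nabla\times E=i\omega\mu(x)H,\qquad \nabla\times H=-i\omega\epsilon E\quad\text{in }\Omega,$$ the second equation being understood in the sense of distributions. If, in addition, $hN\in C^1(\Omega)$ and $E\in C^2(\Omega)$, then, pointwise in $\Omega$, $$\nabla\times\nabla\times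 E=k^2n^2(x)E+\Big[\frac{\nabla\mu(x)}{\mu(x)},\nabla\times E\Big],$$ where $[\cdot,\cdot]$ is the vector product. -/

import Mathlib

open MeasureTheory Topology
open scoped Matrix

noncomputable section

/-- Physical space. -/
abbrev E3 : Type := EuclideanSpace ℝ (Fin 3)

/-- Complex vectors; `u ⬝ᵥ v` and `u ⨯₃ v` below are the bilinear dot product and the vector product. -/
abbrev C3 : Type := Fin 3 → ℂ

/-- The partial derivative `∂F/∂xᵢ` of a vector field. -/
def pderiv (i : Fin 3) (F : E3 → C3) (x : E3) : C3 :=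
  fderiv ℝ F x (EuclideanSpace.single i 1)

/-- The curl `∇ × F` of a vector field. -/
def curl (F : E3 → C3) (x : E3) : C3 :=
  ![pderiv 1 F x 2 - pderiv 2 F x 1,
    pderiv 2 F x 0 - pderiv 0 F x 2,
    pderiv 0 F x 1 - pderiv 1 F x 0]

/-- The gradient of a complex scalar field. -/
def cgrad (f : E3 → ℂ) (x : E3) : C3 :=
  fun i => fderiv ℝ f x (EuclideanSpace.single i 1)

/-- `∇ × F = G` in `Ω` in the sense of distributions (used for continuous fields `F`, `G`). -/
def IsWeakCurlOn (Ω : Set E3) (F G : E3 → C3) : Prop :=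
  ∀ φ : E3 → C3, ContDiff ℝ ((⊤ : ℕ∞) : WithTop ℕ∞) φ → HasCompactSupport φ → tsupport φ ⊆ Ω →
    ∫ x in Ω, F x ⬝ᵥ curl φ x = ∫ x in Ω, G x ⬝ᵥ φ x

/-- The wave number `k = ω √(εμ)` of the original medium. -/
def waveNumber (ω ε μ : ℝ) : ℝ := ω * Real.sqrt (ε * μ)

/-- The outgoing fundamental solution `g(x,y) = e^{ik|x-y|} / (4π|x-y|)` of the Helmholtz equation. -/
def green (k : ℝ) (x y : E3) : ℂ :=
  Complex.exp (Complex.I * k * ‖x - y‖) / (4 * Real.pi * ‖x - y‖)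

/-- The plane wave `𝓔 e^{ik α·x}`. -/
def planeWave (k : ℝ) (α : E3) (A : C3) (x : E3) : C3 :=
  Complex.exp (Complex.I * k * (inner ℝ α x : ℝ)) • A

/-- A particle: a bounded open set `D` with boundary of class `C²` (and finite nonzero surface area),
lying locally on one side of its boundary, whose outward unit normal is `ν`. Near each boundary point
`D` is `{ρ < 0}` with `ρ` of class `C²` and `∇ρ ≠ 0`, and `ν = ∇ρ / |∇ρ|` on the boundary. -/
structure IsParticle (D : Set E3) (ν : E3 → E3) : Prop where
  isOpen : IsOpen D
  isBounded : Bornology.IsBounded D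
  boundary : ∀ s ∈ frontier D, ∃ ρ : E3 → ℝ, ContDiffAt ℝ 2 ρ s ∧ gradient ρ s ≠ 0 ∧
    ∀ᶠ x in 𝓝 s, (x ∈ D ↔ ρ x < 0) ∧
      (x ∈ frontier D → ν x = ‖gradient ρ x‖⁻¹ • gradient ρ x)
  area_ne_zero : μHE[2] (frontier D) ≠ 0
  area_ne_top : μHE[2] (frontier D) ≠ ⊤

/-- The tensor `τ_{jp} = δ_{jp} - |S|⁻¹ ∫_S ν_j ν_p dS` of a particle `D` with boundary `S` and unit
normal `ν`; `μHE[2]` is the surface area. -/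
def shapeTensor (D : Set E3) (ν : E3 → E3) : Matrix (Fin 3) (Fin 3) ℝ :=
  fun j p => (1 : Matrix (Fin 3) (Fin 3) ℝ) j p -
    ((μHE[2] (frontier D)).toReal)⁻¹ * ∫ t in frontier D, ν t j * ν t p ∂μHE[2]

/-- The density `h N τ ∇×E` in the limiting integral equation. -/
def density (h : E3 → ℂ) (N : E3 → ℝ) (τ : Matrix (Fin 3) (Fin 3) ℝ) (E : E3 → C3) (y : E3) : C3 :=
  (h y * N y) • (τ.map (fun r : ℝ => (r : ℂ)) *ᵥ curl E y)

/-- The volume potential `x ↦ ∫_Ω g(x,y) F(y) dy`. -/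
def potential (k : ℝ) (Ω : Set E3) (F : E3 → C3) (x : E3) : C3 :=
  ∫ y in Ω, green k x y • F y

/-- `E` is a limiting field in `Ω` for the incident field `E₀`: a solution of
`E = E₀ - (c₀/(iωμ)) ∇ × ∫_Ω g(·,y) h(y) N(y) τ ∇×E(y) dy` in `Ω`.
The first three fields say that the expressions in the equation are meaningful: `∇ × E` exists and is
continuous, the density is integrable, and the outer curl is a classical one. -/
structure IsLimitingField (ω ε μ c₀ : ℝ) (Ω : Set E3) (h : E3 → ℂ) (N : E3 → ℝ)
    (τ : Matrix (Fin 3) (Fin 3) ℝ) (E₀ E : E3 → C3) : Prop where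
  contDiffOn : ContDiffOn ℝ 1 E Ω
  integrableOn : IntegrableOn (density h N τ E) Ω
  contDiffOn_potential :
    ContDiffOn ℝ 1 (potential (waveNumber ω ε μ) Ω (density h N τ E)) Ω
  equation : ∀ x ∈ Ω, E x = E₀ x -
    ((c₀ : ℂ) / (Complex.I * ω * μ)) •
      curl (potential (waveNumber ω ε μ) Ω (density h N τ E)) x

/-- `(E, H)` solves Maxwell's equations `∇×E = iω m(x) H`, `∇×H = -iωε E` in `Ω`, in a medium with
permittivity `ε` and magnetic permeability `m(x)`. The first equation is classical; `H` is only
continuous, so that the second one is meant in the sense of distributions. -/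
structure IsMaxwellField (ω ε : ℝ) (Ω : Set E3) (m : E3 → ℂ) (E H : E3 → C3) : Prop where
  contDiffOn : ContDiffOn ℝ 1 E Ω
  continuousOn : ContinuousOn H Ω
  faraday : ∀ x ∈ Ω, curl E x = (Complex.I * ω * m x) • H x
  ampere : IsWeakCurlOn Ω H (fun x => (-(Complex.I * ω * ε)) • E x)

/-- The factor `1 + (2c₀/(3iωμ)) h(x) N(x)`. -/
def mediumFactor (ω μ c₀ : ℝ) (h : E3 → ℂ) (N : E3 → ℝ) (x : E3) : ℂ :=
  1 + (2 * c₀ / (3 * Complex.I * ω * μ)) * (h x * N x)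

/-- The permeability `μ(x) = μ / (1 + (2c₀/(3iωμ)) h(x) N(x))`. -/
def limitPermeability (ω μ c₀ : ℝ) (h : E3 → ℂ) (N : E3 → ℝ) (x : E3) : ℂ :=
  μ / mediumFactor ω μ c₀ h N x

end

/-! Since `ν` is a unit vector on `S`, the tensor has trace `3 - 1 = 2`; a multiple of `I` with this
trace is `(2/3) I`. For a ball, the isometries of the sphere make the tensor a multiple of `I`, so
the same trace argument applies and no surface integral is computed.

Put `c = c₀/(iωμ)`, let `F` be the density and `V` its volume potential. Formally `E = E₀ - c ∇×V`
with `(Δ + k²) V = -F`. As `∇×∇× = -Δ` on curls, `∇×∇×E = k² E - c ∇×F`, that is `∇×(∇×E + c F) = k²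
E`. With `τ = (2/3) I` the bracket is `d ∇×E`, where `d` is the medium factor. Division by `iωμ`
turns this into Ampère's law for `H = ∇×E / (iω μ(x))`, because `μ(x) = μ / d` and `k² = ω² ε μ`.

The fields are only `C¹`, so the computation is dual: all further derivatives fall on `ψ = ∇×φ` with
`φ` a test field. This is `IsLimitingField.isWeakCurlOn`. It rests on `isWeakCurlOn_curl`
(integration by parts), `curl_curl_curl` (the identity for smooth curls), `curl_curl_planeWave`, and
the weak Helmholtz equation `setIntegral_potential_dotProduct_helmholtz`.

The last one follows by Fubini from `integral_green_mul_helmholtz`, the fundamental solution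
property of `g`. To prove that, `|x|` is replaced by `√(|x|² + δ²)`. The kernel becomes smooth, its
Helmholtz image is explicit and concentrates at the origin, and `δ → 0` gives the point mass.

For smoother data, `IsWeakCurlOn.eqOn_curl` makes Ampère's law pointwise, and the product rule
applied to `∇×E = iω μ(x) H` yields the second order equation. -/

/-! ### Particles and their tensors -/

/-- The unit normal of a particle is continuous on the boundary. -/
theorem IsParticle.continuousOn_normal {D : Set E3} {ν : E3 → E3} (hD : IsParticle D ν) :
    ContinuousOn ν (frontier D) := by
  intro s hs
  obtain ⟨ρ, hρ, hne, hev⟩ := hD.boundary s hs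
  have hg : ContinuousAt (gradient ρ) s := by
    have h1 : ContDiffAt ℝ 1 (fderiv ℝ ρ) s := hρ.fderiv_right (by norm_num)
    exact (InnerProductSpace.toDual ℝ E3).symm.continuous.continuousAt.comp h1.continuousAt
  have hc : ContinuousAt (fun x => ‖gradient ρ x‖⁻¹ • gradient ρ x) s :=
    (hg.norm.inv₀ (norm_ne_zero_iff.2 hne)).smul hg
  refine hc.continuousWithinAt.congr_of_eventuallyEq ?_ ?_
  · filter_upwards [hev.filter_mono nhdsWithin_le_nhds, self_mem_nhdsWithin] with x hx hxD
    exact hx.2 hxD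
  · exact hev.self_of_nhds.2 hs

theorem IsParticle.norm_normal {D : Set E3} {ν : E3 → E3} (hD : IsParticle D ν) {s : E3}
    (hs : s ∈ frontier D) : ‖ν s‖ = 1 := by
  obtain ⟨ρ, -, hne, hev⟩ := hD.boundary s hs
  rw [hev.self_of_nhds.2 hs, norm_smul, norm_inv, norm_norm,
    inv_mul_cancel₀ (norm_ne_zero_iff.2 hne)]

theorem IsParticle.integrableOn_normal_mul {D : Set E3} {ν : E3 → E3} (hD : IsParticle D ν)
    (i j : Fin 3) : IntegrableOn (fun t => ν t i * ν t j) (frontier D) μHE[2] := by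
  have hm : MeasurableSet (frontier D) := isClosed_frontier.measurableSet
  have hc : ContinuousOn (fun t => ν t i * ν t j) (frontier D) :=
    ((EuclideanSpace.proj (𝕜 := ℝ) i).continuous.comp_continuousOn hD.continuousOn_normal).mul
      ((EuclideanSpace.proj (𝕜 := ℝ) j).continuous.comp_continuousOn hD.continuousOn_normal)
  refine Integrable.mono' (g := fun _ => (1 : ℝ)) (integrableOn_const hD.area_ne_top)
    (hc.aestronglyMeasurable hm) ?_
  refine (ae_restrict_iff' hm).2 (Filter.Eventually.of_forall fun t ht => ?_)
  have h := hD.norm_normal ht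
  have h1 (i : Fin 3) : ‖ν t i‖ ≤ 1 := (PiLp.norm_apply_le (ν t) i).trans h.le
  rw [norm_mul]
  exact mul_le_one₀ (h1 i) (norm_nonneg _) (h1 j)

/-- The tensor of a particle has trace `2`. -/
theorem IsParticle.trace_shapeTensor {D : Set E3} {ν : E3 → E3} (hD : IsParticle D ν) :
    (shapeTensor D ν).trace = 2 := by
  have hm : MeasurableSet (frontier D) := isClosed_frontier.measurableSet
  -- Here `|ν|² = 1` is integrated over the boundary.
  have hsum : ∑ j : Fin 3, ∫ t in frontier D, ν t j * ν t j ∂μHE[2] =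
      (μHE[2] (frontier D)).toReal := by
    rw [← integral_finsetSum _ fun j _ => hD.integrableOn_normal_mul j j,
      setIntegral_congr_fun (g := fun _ => (1 : ℝ)) hm]
    · simp [Measure.real]
    · intro t ht
      have h := hD.norm_normal ht
      rw [EuclideanSpace.norm_eq, Real.sqrt_eq_one] at h
      simpa [pow_two, Real.norm_eq_abs] using h
  have hne : (μHE[2] (frontier D)).toReal ≠ 0 :=
    ENNReal.toReal_ne_zero.2 ⟨hD.area_ne_zero, hD.area_ne_top⟩
  simp only [Matrix.trace, Matrix.diag, shapeTensor, Matrix.one_apply_eq, Finset.sum_sub_distrib,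
    ← Finset.mul_sum, hsum, inv_mul_cancel₀ hne]
  norm_num

/-- If the tensor of a particle is a multiple of the unit tensor, it equals `(2/3) I`. -/
theorem IsParticle.shapeTensor_eq_of_eq_smul_one {D : Set E3} {ν : E3 → E3} (hD : IsParticle D ν)
    {t : ℝ} (ht : shapeTensor D ν = t • (1 : Matrix (Fin 3) (Fin 3) ℝ)) :
    shapeTensor D ν = (2 / 3 : ℝ) • (1 : Matrix (Fin 3) (Fin 3) ℝ) := by
  have h := hD.trace_shapeTensor
  rw [ht, Matrix.trace_smul, Matrix.trace_one] at h
  norm_num at h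
  rw [ht, show t = 2 / 3 by linarith]

/-! ### Spheres -/

/-- Spherical coordinates. -/
noncomputable def sphericalCoord (c : E3) (r : ℝ) (p : EuclideanSpace ℝ (Fin 2)) : E3 :=
  c + r • !₂[Real.sin (p 0) * Real.cos (p 1), Real.sin (p 0) * Real.sin (p 1), Real.cos (p 0)]

theorem contDiff_sphericalCoord (c : E3) (r : ℝ) : ContDiff ℝ 1 (sphericalCoord c r) := by
  unfold sphericalCoord
  refine contDiff_const.add (ContDiff.const_smul r ?_)
  rw [contDiff_euclidean]
  have h (i : Fin 2) : ContDiff ℝ 1 fun p : EuclideanSpace ℝ (Fin 2) => p i :=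
    (EuclideanSpace.proj (𝕜 := ℝ) i).contDiff
  intro i
  fin_cases i
  · exact (Real.contDiff_sin.comp (h 0)).mul (Real.contDiff_cos.comp (h 1))
  · exact (Real.contDiff_sin.comp (h 0)).mul (Real.contDiff_sin.comp (h 1))
  · exact Real.contDiff_cos.comp (h 0)

/-- The angles range over `[0, π] × [-π, π]`, which lies in the disk of radius `2π`. A disk is used
because it is both compact and convex, as the Lipschitz estimate below needs. -/
theorem sphere_subset_image_sphericalCoord (c : E3) {r : ℝ} (hr : 0 < r) :
    Metric.sphere c r ⊆ sphericalCoord c r '' Metric.closedBall 0 (2 * Real.pi) := by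
  intro x hx
  obtain ⟨y, rfl⟩ : ∃ y, x = c + r • y := ⟨r⁻¹ • (x - c), by simp [smul_smul, hr.ne']⟩
  have hy : y 0 ^ 2 + y 1 ^ 2 + y 2 ^ 2 = 1 := by
    have : ‖y‖ = 1 := by
      have : r * ‖y‖ = r := by simpa [norm_smul, abs_of_pos hr] using hx
      exact (mul_eq_left₀ hr.ne').1 this
    rw [EuclideanSpace.norm_eq, Real.sqrt_eq_one] at this
    simpa [Fin.sum_univ_three] using this
  -- The azimuth is the argument of `y₀ + i y₁`, and the modulus of this number is the sine of the
  -- polar angle.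
  set w : ℂ := ⟨y 0, y 1⟩
  have hw : ‖w‖ = Real.sin (Real.arccos (y 2)) := by
    rw [Real.sin_arccos, Complex.norm_eq_sqrt_sq_add_sq]
    congr 1
    change y 0 ^ 2 + y 1 ^ 2 = _
    linarith
  have h2 : Real.cos (Real.arccos (y 2)) = y 2 :=
    Real.cos_arccos (by nlinarith [sq_nonneg (y 0), sq_nonneg (y 1)])
      (by nlinarith [sq_nonneg (y 0), sq_nonneg (y 1)])
  refine ⟨!₂[Real.arccos (y 2), w.arg], ?_, ?_⟩
  · rw [mem_closedBall_zero_iff, EuclideanSpace.norm_eq]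
    refine Real.sqrt_le_iff.2 ⟨by positivity, ?_⟩
    have h3 := Real.arccos_nonneg (y 2)
    have h4 := Real.arccos_le_pi (y 2)
    have h5 := abs_le.1 (Complex.abs_arg_le_pi w)
    simp only [Fin.sum_univ_two, Real.norm_eq_abs, sq_abs]
    simp
    nlinarith
  · unfold sphericalCoord
    congr 2
    ext i
    fin_cases i
    · simpa [← hw, -Complex.norm_mul_cos_arg] using Complex.norm_mul_cos_arg w
    · simpa [← hw, -Complex.norm_mul_sin_arg] using Complex.norm_mul_sin_arg w
    · simpa using h2

/-- The sphere is covered by a Lipschitz image of a compact planar disk, and two-dimensional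
Hausdorff measure on the plane is a Haar measure. -/
theorem euclideanHausdorffMeasure_sphere_ne_top (c : E3) {r : ℝ} (hr : 0 < r) :
    μHE[2] (Metric.sphere c r) ≠ ⊤ := by
  obtain ⟨K, hK⟩ := LocallyLipschitzOn.exists_lipschitzOnWith_of_compact
    (isCompact_closedBall 0 (2 * Real.pi))
    ((contDiff_sphericalCoord c r).contDiffOn.locallyLipschitzOn (convex_closedBall _ _))
  have hfin : μH[2] (Metric.closedBall (0 : EuclideanSpace ℝ (Fin 2)) (2 * Real.pi)) < ⊤ := by
    have : Measure.IsAddHaarMeasure (μH[(2 : ℕ)] : Measure (EuclideanSpace ℝ (Fin 2))) :=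
      inferInstance
    exact_mod_cast (isCompact_closedBall (0 : EuclideanSpace ℝ (Fin 2))
      (2 * Real.pi)).measure_lt_top (μ := μH[(2 : ℕ)])
  have h1 : μH[2] (Metric.sphere c r) < ⊤ := by
    refine (measure_mono (sphere_subset_image_sphericalCoord c hr)).trans_lt
      ((hK.hausdorffMeasure_image_le zero_le_two).trans_lt (ENNReal.mul_lt_top ?_ hfin))
    exact ENNReal.rpow_lt_top_of_nonneg zero_le_two ENNReal.coe_ne_top
  rw [Measure.euclideanHausdorffMeasure_def, Measure.smul_apply, ENNReal.smul_def, smul_eq_mul]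
  exact (ENNReal.mul_lt_top ENNReal.coe_lt_top (by exact_mod_cast h1)).ne

/-- Orthogonal projection to a coordinate plane does not increase Hausdorff measure, and the shadow
of the sphere contains an open disk. -/
theorem euclideanHausdorffMeasure_sphere_ne_zero (c : E3) {r : ℝ} (hr : 0 < r) :
    μHE[2] (Metric.sphere c r) ≠ 0 := by
  let f : E3 → EuclideanSpace ℝ (Fin 2) := fun x => !₂[x 0, x 1]
  have hf : LipschitzWith 1 f := by
    refine LipschitzWith.of_dist_le_mul fun x y => ?_
    rw [NNReal.coe_one, one_mul, EuclideanSpace.dist_eq, EuclideanSpace.dist_eq]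
    refine Real.sqrt_le_sqrt ?_
    simp only [Fin.sum_univ_two, Fin.sum_univ_three, f]
    simp
  have hsub : Metric.ball (f c) r ⊆ f '' Metric.sphere c r := by
    intro p hp
    rw [Metric.mem_ball, EuclideanSpace.dist_eq, Real.sqrt_lt' hr, Fin.sum_univ_two,
      Real.dist_eq, Real.dist_eq, sq_abs, sq_abs] at hp
    change (p 0 - c 0) ^ 2 + (p 1 - c 1) ^ 2 < r ^ 2 at hp
    -- The preimage is taken on the upper hemisphere.
    refine ⟨!₂[p 0, p 1, c 2 + √(r ^ 2 - ((p 0 - c 0) ^ 2 + (p 1 - c 1) ^ 2))], ?_, ?_⟩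
    · rw [Metric.mem_sphere, EuclideanSpace.dist_eq, Real.sqrt_eq_iff_eq_sq (by positivity) hr.le,
        Fin.sum_univ_three]
      simp only [Real.dist_eq, sq_abs]
      simp [Real.sq_sqrt (sub_nonneg.2 hp.le)]
    · ext i
      fin_cases i <;> rfl
  intro h0
  have h1 : μH[2] (Metric.sphere c r) = 0 := by
    rw [Measure.euclideanHausdorffMeasure_def, Measure.smul_apply, ENNReal.smul_def, smul_eq_mul,
      mul_eq_zero] at h0
    have h := h0.resolve_left
      (by exact_mod_cast Measure.addHaarScalarFactor_volume_hausdorffMeasure_ne_zero 2)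
    exact_mod_cast h
  have h2 := (measure_mono hsub).trans (hf.hausdorffMeasure_image_le zero_le_two _)
  rw [h1, mul_zero] at h2
  have h3 : 0 < μH[(2 : ℕ)] (Metric.ball (f c) r) := Metric.measure_ball_pos _ _ hr
  exact absurd (le_antisymm (by exact_mod_cast h2) bot_le) h3.ne'

/-- Balls are particles. -/
theorem isParticle_ball (c : E3) {r : ℝ} (hr : 0 < r) :
    IsParticle (Metric.ball c r) (fun x => r⁻¹ • (x - c)) := by
  have hfr : frontier (Metric.ball c r) = Metric.sphere c r := frontier_ball c hr.ne'
  have hgrad (x : E3) : HasGradientAt (fun y => ‖y - c‖ ^ 2 - r ^ 2) ((2 : ℝ) • (x - c)) x := by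
    have h := (((hasFDerivAt_id x).sub_const c).norm_sq).sub_const (r ^ 2)
    rw [hasGradientAt_iff_hasFDerivAt]
    refine h.congr_fderiv ?_
    ext v
    simp
  refine ⟨Metric.isOpen_ball, Metric.isBounded_ball, ?_, ?_, ?_⟩
  · intro s hs
    rw [hfr, mem_sphere_iff_norm] at hs
    refine ⟨fun y => ‖y - c‖ ^ 2 - r ^ 2, ?_, ?_, Filter.Eventually.of_forall fun x => ⟨?_, ?_⟩⟩
    · exact (((contDiff_id.sub contDiff_const).norm_sq ℝ).sub contDiff_const).contDiffAt
    · rw [(hgrad s).gradient, ← norm_ne_zero_iff, norm_smul, hs]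
      simp [hr.ne']
    · rw [mem_ball_iff_norm, sub_neg, sq_lt_sq₀ (norm_nonneg _) hr.le]
    · intro hx
      rw [hfr, mem_sphere_iff_norm] at hx
      rw [(hgrad x).gradient, norm_smul, hx, smul_smul, Real.norm_ofNat]
      congr 1
      field_simp
  · rw [hfr]
    exact euclideanHausdorffMeasure_sphere_ne_zero c hr
  · rw [hfr]
    exact euclideanHausdorffMeasure_sphere_ne_top c hr

/-- Conjugating `e` by the translation to the center gives an isometry of space that preserves both
the sphere and the Hausdorff measure. -/
theorem setIntegral_sphere_comp_isometry (c : E3) {r : ℝ} (e : E3 ≃ₗᵢ[ℝ] E3) (f : E3 → ℝ) :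
    ∫ t in Metric.sphere c r, f (e (r⁻¹ • (t - c))) ∂μHE[2] =
      ∫ t in Metric.sphere c r, f (r⁻¹ • (t - c)) ∂μHE[2] := by
  let T : E3 ≃ᵢ E3 :=
    ((IsometryEquiv.subRight c).trans e.toIsometryEquiv).trans (IsometryEquiv.addRight c)
  have hT (t : E3) : T t = e (t - c) + c := rfl
  have h := (T.measurePreserving_euclideanHausdorffMeasure 2).setIntegral_preimage_emb
    T.toHomeomorph.measurableEmbedding (fun t => f (r⁻¹ • (t - c))) (Metric.sphere c r)
  rw [← h]
  have hs : T ⁻¹' Metric.sphere c r = Metric.sphere c r := by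
    ext t
    rw [Set.mem_preimage, hT, mem_sphere_iff_norm, mem_sphere_iff_norm, add_sub_cancel_right,
      e.norm_map]
  rw [hs]
  simp only [hT, add_sub_cancel_right, map_smul]

/-- The tensor of a ball is `(2/3) I`. -/
theorem shapeTensor_ball (c : E3) {r : ℝ} (hr : 0 < r) :
    shapeTensor (Metric.ball c r) (fun x => r⁻¹ • (x - c)) =
      (2 / 3 : ℝ) • (1 : Matrix (Fin 3) (Fin 3) ℝ) := by
  have hfr : frontier (Metric.ball c r) = Metric.sphere c r := frontier_ball c hr.ne'
  let I (j p : Fin 3) : ℝ :=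
    ∫ t in Metric.sphere c r, (r⁻¹ • (t - c)) j * (r⁻¹ • (t - c)) p ∂μHE[2]
  -- Invariance under the exchange of two coordinates.
  have hdiag (j p : Fin 3) : I j j = I p p := by
    have := setIntegral_sphere_comp_isometry c (r := r)
      (LinearIsometryEquiv.piLpCongrLeft 2 ℝ ℝ (Equiv.swap j p)) (fun x => x p * x p)
    simpa [I, -mul_eq_mul_left_iff, Equiv.piCongrLeft'] using this
  -- Reflection of the `j`-th coordinate changes the sign of the integrand.
  have hoff (j p : Fin 3) (hjp : j ≠ p) : I j p = 0 := by
    have := setIntegral_sphere_comp_isometry c (r := r)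
      (LinearIsometryEquiv.piLpCongrRight 2 fun i =>
        if i = j then LinearIsometryEquiv.neg ℝ else LinearIsometryEquiv.refl ℝ ℝ)
      (fun x => x j * x p)
    simp only [LinearIsometryEquiv.piLpCongrRight_apply, if_true, if_neg hjp.symm,
      LinearIsometryEquiv.coe_neg, LinearIsometryEquiv.coe_refl, id, neg_mul, integral_neg] at this
    change -I j p = I j p at this
    linarith
  refine (isParticle_ball c hr).shapeTensor_eq_of_eq_smul_one
    (t := 1 - ((μHE[2] (Metric.sphere c r)).toReal)⁻¹ * I 0 0) ?_
  ext j p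
  simp only [shapeTensor, hfr, Matrix.smul_apply, smul_eq_mul]
  change _ - _ * I j p = _
  by_cases hjp : j = p
  · subst hjp
    simp [hdiag j 0]
  · simp [hoff j p hjp, Matrix.one_apply_ne hjp]

/-! ### Partial derivatives of scalar fields and integration by parts -/

/-- The partial derivative `∂u/∂xᵢ` of a scalar field. -/
noncomputable def spderiv (i : Fin 3) (u : E3 → ℂ) (x : E3) : ℂ :=
  fderiv ℝ u x (EuclideanSpace.single i 1)

/-- The Helmholtz operator `Δ + k²` on scalar fields. -/
noncomputable def helmholtz (k : ℝ) (u : E3 → ℂ) (x : E3) : ℂ :=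
  (∑ i, spderiv i (spderiv i u) x) + (k : ℂ) ^ 2 * u x

theorem ContDiff.spderiv {m n : WithTop ℕ∞} {u : E3 → ℂ} (hu : ContDiff ℝ n u) (h : m + 1 ≤ n)
    (i : Fin 3) : ContDiff ℝ m (spderiv i u) :=
  (hu.fderiv_right h).clm_apply contDiff_const

theorem ContDiffOn.spderiv {m n : WithTop ℕ∞} {Ω : Set E3} {u : E3 → ℂ} (hu : ContDiffOn ℝ n u Ω)
    (hΩ : IsOpen Ω) (h : m + 1 ≤ n) (i : Fin 3) : ContDiffOn ℝ m (spderiv i u) Ω :=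
  (hu.fderiv_of_isOpen hΩ h).clm_apply contDiffOn_const

theorem tsupport_spderiv_subset (i : Fin 3) (u : E3 → ℂ) : tsupport (spderiv i u) ⊆ tsupport u :=
  tsupport_fderiv_apply_subset ℝ _

theorem HasCompactSupport.spderiv {u : E3 → ℂ} (hu : HasCompactSupport u) (i : Fin 3) :
    HasCompactSupport (spderiv i u) :=
  hu.fderiv_apply ℝ _

theorem integrable_mul_of_tsupport_subset {Ω : Set E3} {u w : E3 → ℂ} (hu : ContinuousOn u Ω)
    (hw : Continuous w) (hc : HasCompactSupport w) (hs : tsupport w ⊆ Ω) :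
    Integrable fun x => u x * w x := by
  rw [← integrableOn_iff_integrable_of_support_subset (s := tsupport w)]
  · exact ((hu.mono hs).mul hw.continuousOn).integrableOn_compact hc
  · exact (Function.support_mul_subset_right u w).trans (subset_tsupport w)

/-- There is no boundary term, as `w` has compact support in `Ω`. The values of `u` outside `Ω` are
arbitrary and play no role, so the integrals may be taken over the whole space. -/
theorem integral_mul_spderiv {Ω : Set E3} (hΩ : IsOpen Ω) {u w : E3 → ℂ} (hu : ContDiffOn ℝ 1 u Ω)
    (hw : ContDiff ℝ 1 w) (hc : HasCompactSupport w) (hs : tsupport w ⊆ Ω) (i : Fin 3) :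
    ∫ x, u x * spderiv i w x = -∫ x, spderiv i u x * w x :=
  integral_mul_fderiv_eq_neg_fderiv_mul_of_integrable
    (integrable_mul_of_tsupport_subset (hu.spderiv hΩ (m := 0) (by simp) i).continuousOn
      hw.continuous hc hs)
    (integrable_mul_of_tsupport_subset hu.continuousOn
      (hw.spderiv (m := 0) (by simp) i).continuous (hc.spderiv i)
      ((tsupport_spderiv_subset i w).trans hs))
    (integrable_mul_of_tsupport_subset hu.continuousOn hw.continuous hc hs)
    (fun x hx => (hu.contDiffAt (hΩ.mem_nhds (hs hx))).differentiableAt one_ne_zero)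
    (fun x _ => hw.differentiable one_ne_zero x)

theorem helmholtz_continuous (k : ℝ) {w : E3 → ℂ} (hw : ContDiff ℝ 2 w) :
    Continuous (helmholtz k w) :=
  (continuous_finsetSum _ fun i _ => ((hw.spderiv (m := 1) (by norm_num) i).spderiv (m := 0)
    (by simp) i).continuous).add (continuous_const.mul hw.continuous)

theorem tsupport_helmholtz_subset (k : ℝ) (w : E3 → ℂ) :
    tsupport (helmholtz k w) ⊆ tsupport w := by
  refine closure_minimal (fun x hx => ?_) (isClosed_tsupport w)
  by_contra hxw
  refine hx ?_
  have h (i : Fin 3) : spderiv i (spderiv i w) x = 0 := image_eq_zero_of_notMem_tsupport fun h =>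
    hxw (tsupport_spderiv_subset i w (tsupport_spderiv_subset i _ h))
  simp [helmholtz, h, image_eq_zero_of_notMem_tsupport hxw]

theorem HasCompactSupport.helmholtz (k : ℝ) {w : E3 → ℂ} (hc : HasCompactSupport w) :
    HasCompactSupport (helmholtz k w) :=
  hc.of_isClosed_subset (isClosed_tsupport _) (tsupport_helmholtz_subset k w)

/-- The Helmholtz operator is formally self-adjoint. -/
theorem integral_mul_helmholtz (k : ℝ) {u w : E3 → ℂ} (hu : ContDiff ℝ 2 u)
    (hw : ContDiff ℝ 2 w) (hc : HasCompactSupport w) :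
    ∫ x, u x * helmholtz k w x = ∫ x, helmholtz k u x * w x := by
  have hu1 (i : Fin 3) : ContDiff ℝ 1 (spderiv i u) := hu.spderiv (by norm_num) i
  have hw1 (i : Fin 3) : ContDiff ℝ 1 (spderiv i w) := hw.spderiv (by norm_num) i
  have hint {f g : E3 → ℂ} (hf : Continuous f) (hg : Continuous g) (hgc : HasCompactSupport g) :
      Integrable fun x => f x * g x :=
    integrable_mul_of_tsupport_subset hf.continuousOn hg hgc (Set.subset_univ _)
  have hparts (i : Fin 3) : ∫ x, u x * spderiv i (spderiv i w) x =
      ∫ x, spderiv i (spderiv i u) x * w x := by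
    rw [integral_mul_spderiv isOpen_univ (hu.of_le one_le_two).contDiffOn (hw1 i) (hc.spderiv i)
        (Set.subset_univ _) i,
      integral_mul_spderiv isOpen_univ (hu1 i).contDiffOn (hw.of_le one_le_two) hc
        (Set.subset_univ _) i, neg_neg]
  simp only [helmholtz, mul_add, add_mul, Finset.mul_sum, Finset.sum_mul]
  rw [integral_add, integral_add, integral_finsetSum, integral_finsetSum]
  · simp only [hparts]
    congr 2
    ext x
    ring
  · exact fun i _ => hint ((hu1 i).spderiv (m := 0) (by simp) i).continuous hw.continuous hc
  · exact fun i _ => hint hu.continuous ((hw1 i).spderiv (m := 0) (by simp) i).continuous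
      ((hc.spderiv i).spderiv i)
  · exact integrable_finsetSum _ fun i _ =>
      hint ((hu1 i).spderiv (m := 0) (by simp) i).continuous hw.continuous hc
  · simp only [mul_assoc]
    exact (hint hu.continuous hw.continuous hc).const_mul _
  · exact integrable_finsetSum _ fun i _ =>
      hint hu.continuous ((hw1 i).spderiv (m := 0) (by simp) i).continuous
        ((hc.spderiv i).spderiv i)
  · simp only [mul_left_comm (u _)]
    exact (hint hu.continuous hw.continuous hc).const_mul _

/-! ### The regularized fundamental solution -/

/-- The regularized distance to the origin. -/
noncomputable def regNorm (δ : ℝ) (x : E3) : ℝ := √(‖x‖ ^ 2 + δ ^ 2)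

theorem regNorm_pos {δ : ℝ} (hδ : 0 < δ) (x : E3) : 0 < regNorm δ x :=
  Real.sqrt_pos.2 (by positivity)

theorem regNorm_sq (δ : ℝ) (x : E3) : regNorm δ x ^ 2 = ‖x‖ ^ 2 + δ ^ 2 :=
  Real.sq_sqrt (by positivity)

theorem norm_le_regNorm (δ : ℝ) (x : E3) : ‖x‖ ≤ regNorm δ x :=
  Real.le_sqrt_of_sq_le (by nlinarith [sq_nonneg δ])

theorem contDiff_regNorm {δ : ℝ} (hδ : 0 < δ) {n : WithTop ℕ∞} : ContDiff ℝ n (regNorm δ) :=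
  ((contDiff_id.norm_sq ℝ).add contDiff_const).sqrt fun x => by
    have : 0 < δ ^ 2 := by positivity
    simp only [id]
    positivity

theorem hasFDerivAt_regNorm {δ : ℝ} (hδ : 0 < δ) (x : E3) :
    HasFDerivAt (regNorm δ) ((regNorm δ x)⁻¹ • innerSL ℝ x) x := by
  have hpos : ‖x‖ ^ 2 + δ ^ 2 ≠ 0 := by positivity
  have h := (((hasFDerivAt_id x).norm_sq).add_const (δ ^ 2)).sqrt hpos
  refine h.congr_fderiv ?_
  ext v
  have := (regNorm_pos hδ x).ne'
  simp only [regNorm] at *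
  simp
  field_simp

theorem spderiv_comp_regNorm {δ : ℝ} (hδ : 0 < δ) {Φ : ℝ → ℂ} {Φ' : ℂ} {x : E3}
    (h : HasDerivAt Φ Φ' (regNorm δ x)) (i : Fin 3) :
    spderiv i (fun y => Φ (regNorm δ y)) x = x i / regNorm δ x * Φ' := by
  have h1 := h.hasFDerivAt.comp x (hasFDerivAt_regNorm hδ x)
  change fderiv ℝ (Φ ∘ regNorm δ) x _ = _
  rw [h1.fderiv]
  simp [EuclideanSpace.inner_single_right]
  ring

/-- The regularized fundamental solution, without the factor `1/(4π)`. -/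
noncomputable def regGreen (k δ : ℝ) (x : E3) : ℂ :=
  Complex.exp (Complex.I * k * regNorm δ x) / regNorm δ x

theorem contDiff_regGreen (k : ℝ) {δ : ℝ} (hδ : 0 < δ) {n : WithTop ℕ∞} :
    ContDiff ℝ n (regGreen k δ) := by
  have h : ContDiff ℝ n fun x => (regNorm δ x : ℂ) :=
    Complex.ofRealCLM.contDiff.comp (contDiff_regNorm hδ)
  unfold regGreen
  simp only [div_eq_mul_inv]
  exact (contDiff_const.mul h).cexp.mul (h.inv fun x => by exact_mod_cast (regNorm_pos hδ x).ne')

theorem hasDerivAt_exp_ofReal (k ρ : ℝ) :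
    HasDerivAt (fun r : ℝ => Complex.exp (Complex.I * k * r))
      (Complex.exp (Complex.I * k * ρ) * (Complex.I * k)) ρ := by
  simpa using ((Complex.ofRealCLM.hasDerivAt (x := ρ)).const_mul (Complex.I * k)).cexp

theorem hasDerivAt_exp_div (k : ℝ) {ρ : ℝ} (hρ : ρ ≠ 0) :
    HasDerivAt (fun r : ℝ => Complex.exp (Complex.I * k * r) / r)
      (Complex.exp (Complex.I * k * ρ) * (Complex.I * k * ρ - 1) / ρ ^ 2) ρ := by
  have h := (hasDerivAt_exp_ofReal k ρ).div (Complex.ofRealCLM.hasDerivAt (x := ρ))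
    (by simpa using hρ)
  refine h.congr_deriv ?_
  simp
  ring

/-- The function differentiated here is `f'(r)/r` for `f(r) = e^{ikr}/r`. It appears because the
first derivatives of a radial function `f(ρ)` are `xᵢ f'(ρ)/ρ`. -/
theorem hasDerivAt_exp_div_cube (k : ℝ) {ρ : ℝ} (hρ : ρ ≠ 0) :
    HasDerivAt (fun r : ℝ => Complex.exp (Complex.I * k * r) * (Complex.I * k * r - 1) / r ^ 3)
      (Complex.exp (Complex.I * k * ρ) * (3 - 3 * Complex.I * k * ρ - k ^ 2 * ρ ^ 2) / ρ ^ 4) ρ := by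
  have hr : HasDerivAt (fun r : ℝ => (r : ℂ)) 1 ρ := by
    simpa using (hasDerivAt_id ρ).ofReal_comp
  have hρ' : (ρ : ℂ) ≠ 0 := by exact_mod_cast hρ
  have h := ((hasDerivAt_exp_ofReal k ρ).mul ((hr.const_mul (Complex.I * k)).sub_const 1)).div
    (hr.pow 3) (pow_ne_zero 3 hρ')
  refine h.congr_deriv ?_
  simp
  field_simp
  linear_combination (ρ ^ 2 * k ^ 2 : ℂ) * Complex.I_sq

/-- The profile of `(Δ + k²)` applied to the regularized fundamental solution. -/
noncomputable def regSource (k ρ : ℝ) : ℂ :=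
  Complex.exp (Complex.I * k * ρ) * (3 - 3 * Complex.I * k * ρ - k ^ 2 * ρ ^ 2)

theorem spderiv_regGreen (k : ℝ) {δ : ℝ} (hδ : 0 < δ) (i : Fin 3) :
    spderiv i (regGreen k δ) = fun x => (x i : ℂ) * (Complex.exp (Complex.I * k * regNorm δ x) *
      (Complex.I * k * regNorm δ x - 1) / regNorm δ x ^ 3) := by
  ext x
  have hne := (regNorm_pos hδ x).ne'
  have hne' : (regNorm δ x : ℂ) ≠ 0 := by exact_mod_cast hne
  rw [show regGreen k δ = fun y => (fun r : ℝ => Complex.exp (Complex.I * k * r) / r) (regNorm δ y)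
    from rfl, spderiv_comp_regNorm hδ (hasDerivAt_exp_div k hne)]
  field_simp

theorem spderiv_spderiv_regGreen (k : ℝ) {δ : ℝ} (hδ : 0 < δ) (i : Fin 3) (x : E3) :
    spderiv i (spderiv i (regGreen k δ)) x =
      Complex.exp (Complex.I * k * regNorm δ x) *
        (Complex.I * k * regNorm δ x - 1) / regNorm δ x ^ 3 +
      x i ^ 2 * (regSource k (regNorm δ x) / regNorm δ x ^ 5) := by
  have hne := (regNorm_pos hδ x).ne'
  have hne' : (regNorm δ x : ℂ) ≠ 0 := by exact_mod_cast hne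
  set P : ℝ → ℂ := fun r => Complex.exp (Complex.I * k * r) * (Complex.I * k * r - 1) / r ^ 3
    with hP
  have hPd := hasDerivAt_exp_div_cube k hne
  have h1 : HasFDerivAt (fun y : E3 => (y i : ℂ))
      (Complex.ofRealCLM.comp (EuclideanSpace.proj (𝕜 := ℝ) i)) x :=
    (Complex.ofRealCLM.comp (EuclideanSpace.proj (𝕜 := ℝ) i)).hasFDerivAt
  have h2 : DifferentiableAt ℝ (fun y : E3 => P (regNorm δ y)) x :=
    (hPd.hasFDerivAt.comp x (hasFDerivAt_regNorm hδ x)).differentiableAt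
  have h3 := spderiv_comp_regNorm hδ hPd i
  rw [spderiv_regGreen k hδ i]
  unfold spderiv at h3 ⊢
  have h4 : fderiv ℝ (fun y : E3 => (y i : ℂ) * P (regNorm δ y)) x = _ :=
    (h1.mul h2.hasFDerivAt).fderiv
  change fderiv ℝ (fun y : E3 => (y i : ℂ) * P (regNorm δ y)) x _ = _
  rw [h4]
  simp only [add_apply, smul_apply, hP, h3, regSource]
  simp
  field_simp
  ring

/-- In the sum of the second derivatives `|x|² = ρ² - δ²`. The `ρ²` part cancels against the
remaining terms, exactly as for the true fundamental solution off the origin, and only the `δ²` part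
survives. -/
theorem helmholtz_regGreen (k : ℝ) {δ : ℝ} (hδ : 0 < δ) (x : E3) :
    helmholtz k (regGreen k δ) x =
      -(δ ^ 2 * (regSource k (regNorm δ x) / regNorm δ x ^ 5)) := by
  have hne' : (regNorm δ x : ℂ) ≠ 0 := by exact_mod_cast (regNorm_pos hδ x).ne'
  have hx : (x 0 : ℂ) ^ 2 + (x 1 : ℂ) ^ 2 + (x 2 : ℂ) ^ 2 = regNorm δ x ^ 2 - δ ^ 2 := by
    have h := regNorm_sq δ x
    rw [EuclideanSpace.norm_sq_eq, Fin.sum_univ_three] at h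
    simp only [Real.norm_eq_abs, sq_abs] at h
    rw [← sub_eq_iff_eq_add] at h
    exact_mod_cast h.symm
  simp only [helmholtz, Fin.sum_univ_three, spderiv_spderiv_regGreen k hδ]
  have hsum (a b : ℂ) : a + x 0 ^ 2 * b + (a + x 1 ^ 2 * b) + (a + x 2 ^ 2 * b) =
      3 * a + (regNorm δ x ^ 2 - δ ^ 2) * b := by
    rw [← hx]
    ring
  rw [hsum, regSource, regGreen]
  field_simp
  ring

/-! ### The fundamental solution of the Helmholtz equation -/

theorem regNorm_smul {δ : ℝ} (hδ : 0 < δ) (y : E3) : regNorm δ (δ • y) = δ * regNorm 1 y := by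
  rw [regNorm, regNorm, norm_smul, Real.norm_of_nonneg hδ.le,
    show (δ * ‖y‖) ^ 2 + δ ^ 2 = δ ^ 2 * (‖y‖ ^ 2 + 1 ^ 2) by ring,
    Real.sqrt_mul (by positivity), Real.sqrt_sq hδ.le]

theorem continuous_regNorm_uncurry : Continuous fun p : ℝ × E3 => regNorm p.1 p.2 := by
  unfold regNorm
  fun_prop

/-- The decay exponent `5` exceeds the dimension `3`. -/
theorem integrable_inv_regNorm_pow_five : Integrable fun y : E3 => (regNorm 1 y ^ 5)⁻¹ := by
  have h := integrable_rpow_neg_one_add_norm_sq (E := E3) (μ := volume) (r := 5)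
    (by simp; norm_num)
  refine h.congr (Filter.Eventually.of_forall fun y => ?_)
  have h1 : (0 : ℝ) ≤ 1 + ‖y‖ ^ 2 := by positivity
  simp only [regNorm, one_pow]
  rw [neg_div, Real.rpow_neg h1, add_comm (‖y‖ ^ 2), Real.sqrt_eq_rpow, ← Real.rpow_natCast ((1 + ‖y‖ ^ 2) ^ (1 / 2 : ℝ)) 5,
    ← Real.rpow_mul h1]
  norm_num

theorem integral_inv_regNorm_pow_five :
    ∫ y : E3, (regNorm 1 y ^ 5)⁻¹ = 4 * Real.pi / 3 := by
  have h := integral_fun_norm_addHaar (volume : Measure E3) fun r : ℝ => (√(r ^ 2 + 1) ^ 5)⁻¹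
  have h1 : ∫ r in Set.Ioi (0 : ℝ), r ^ 2 * (√(r ^ 2 + 1) ^ 5)⁻¹ = 1 / 3 := by
    have hs (r : ℝ) : 0 < √(r ^ 2 + 1) := Real.sqrt_pos.2 (by positivity)
    -- An explicit antiderivative of the radial integrand left by polar coordinates; it increases
    -- from `0` to `1/3`.
    have hd (r : ℝ) : HasDerivAt (fun r : ℝ => (r / √(r ^ 2 + 1)) ^ 3 / 3)
        (r ^ 2 * (√(r ^ 2 + 1) ^ 5)⁻¹) r := by
      have hq : HasDerivAt (fun r : ℝ => √(r ^ 2 + 1)) (r / √(r ^ 2 + 1)) r := by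
        refine (((hasDerivAt_pow 2 r).add_const 1).sqrt (by positivity)).congr_deriv ?_
        have := (hs r).ne'
        field_simp
        norm_num
      refine ((((hasDerivAt_id r).div hq (hs r).ne').pow 3).div_const 3).congr_deriv ?_
      have h5 := (hs r).ne'
      have h6 : √(r ^ 2 + 1) ^ 2 = r ^ 2 + 1 := Real.sq_sqrt (by positivity)
      simp
      field_simp
      rw [h6]
      ring
    have ht : Filter.Tendsto (fun r : ℝ => (r / √(r ^ 2 + 1)) ^ 3 / 3) Filter.atTop
        (𝓝 (1 / 3)) := by
      have h2 : Filter.Tendsto (fun r : ℝ => r / √(r ^ 2 + 1)) Filter.atTop (𝓝 1) := by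
        have h3 : Filter.Tendsto (fun r : ℝ => √(1 - (r ^ 2 + 1)⁻¹)) Filter.atTop
            (𝓝 (√(1 - 0))) := by
          refine (Real.continuous_sqrt.tendsto _).comp (tendsto_const_nhds.sub ?_)
          exact tendsto_inv_atTop_zero.comp
            (Filter.tendsto_atTop_add_const_right _ _ (Filter.tendsto_pow_atTop two_ne_zero))
        rw [sub_zero, Real.sqrt_one] at h3
        refine h3.congr' ?_
        filter_upwards [Filter.eventually_ge_atTop 0] with r hr
        rw [show 1 - (r ^ 2 + 1)⁻¹ = r ^ 2 / (r ^ 2 + 1) by field_simp; ring,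
          Real.sqrt_div (by positivity), Real.sqrt_sq hr]
      simpa using (h2.pow 3).div_const 3
    have := integral_Ioi_of_hasDerivAt_of_nonneg' (a := 0) (fun r _ => hd r)
      (fun r _ => by positivity) ht
    simpa using this
  have h2 : (volume : Measure E3).real (Metric.ball 0 1) = 4 * Real.pi / 3 := by
    rw [Measure.real, EuclideanSpace.volume_ball_fin_three, ENNReal.ofReal_one, one_pow, one_mul,
      ENNReal.toReal_ofReal (by positivity)]
    ring
  simp only [finrank_euclideanSpace, Fintype.card_fin, smul_eq_mul, nsmul_eq_mul,
    Nat.add_one_sub_one, h2] at h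
  simp only [regNorm, one_pow]
  rw [h]
  norm_num [h1]
  ring

theorem continuous_regSource (k : ℝ) : Continuous (regSource k) := by
  unfold regSource
  fun_prop

theorem norm_exp_I_mul_ofReal (k r : ℝ) : ‖Complex.exp (Complex.I * k * r)‖ = 1 := by
  rw [show Complex.I * (k : ℂ) * r = ((k * r : ℝ) : ℂ) * Complex.I by push_cast; ring,
    Complex.norm_exp_ofReal_mul_I]

/-- The operator is moved to the smooth kernel and `x = δ y` is substituted. The powers `δ² · δ³ ·
δ⁻⁵` cancel, leaving a fixed integrable weight, so the source is an approximate identity. -/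
theorem integral_regGreen_mul_helmholtz (k : ℝ) {δ : ℝ} (hδ : 0 < δ) {w : E3 → ℂ}
    (hw : ContDiff ℝ 2 w) (hc : HasCompactSupport w) :
    ∫ x, regGreen k δ x * helmholtz k w x =
      -∫ y : E3, (regNorm 1 y ^ 5)⁻¹ • (regSource k (regNorm δ (δ • y)) * w (δ • y)) := by
  rw [integral_mul_helmholtz k (contDiff_regGreen k hδ) hw hc]
  simp only [helmholtz_regGreen k hδ]
  have h := Measure.integral_comp_smul (volume : Measure E3)
    (fun x => -(δ ^ 2 * (regSource k (regNorm δ x) / regNorm δ x ^ 5)) * w x) δ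
  rw [← integral_neg]
  have h3 : |(δ ^ Module.finrank ℝ E3)⁻¹| = (δ ^ 3)⁻¹ := by
    rw [finrank_euclideanSpace, Fintype.card_fin, abs_of_pos (by positivity)]
  rw [h3, eq_inv_smul_iff₀ (by positivity), ← integral_smul] at h
  rw [← h]
  congr 1
  ext y
  have h1 : (regNorm 1 y : ℂ) ≠ 0 := by exact_mod_cast (regNorm_pos one_pos y).ne'
  have h2 : (δ : ℂ) ≠ 0 := by exact_mod_cast hδ.ne'
  rw [regNorm_smul hδ, Complex.real_smul, Complex.real_smul]
  push_cast
  field_simp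

theorem locallyIntegrable_exp_div_norm (k : ℝ) :
    LocallyIntegrable fun x : E3 => Complex.exp (Complex.I * k * ‖x‖) / (‖x‖ : ℂ) := by
  refine locallyIntegrable_of_norm_le_rpow (C := 1) (α := 1) (by simp) (by simp)
    (Filter.Eventually.of_forall fun x => ?_) ?_
  · rw [norm_div, norm_exp_I_mul_ofReal, Complex.norm_real, norm_norm, Real.rpow_neg_one, one_mul,
      one_div]
  · exact (Measurable.div (by fun_prop) (by fun_prop)).aestronglyMeasurable

/-- The exponential is unimodular and the regularized distance is at least `|x|`, so the singular
integrand, which is integrable in dimension three, dominates. -/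
theorem tendsto_integral_regGreen_mul (k : ℝ) {w : E3 → ℂ} (hw : Continuous w)
    (hc : HasCompactSupport w) :
    Filter.Tendsto (fun δ => ∫ x, regGreen k δ x * w x) (𝓝[>] 0)
      (𝓝 (∫ x : E3, Complex.exp (Complex.I * k * ‖x‖) / (‖x‖ : ℂ) * w x)) := by
  refine tendsto_integral_filter_of_dominated_convergence
    (fun x : E3 => ‖Complex.exp (Complex.I * k * ‖x‖) / (‖x‖ : ℂ) * w x‖) ?_ ?_ ?_ ?_
  · filter_upwards [self_mem_nhdsWithin] with δ hδ
    exact ((contDiff_regGreen k hδ (n := 0)).continuous.mul hw).aestronglyMeasurable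
  · filter_upwards [self_mem_nhdsWithin] with δ hδ
    filter_upwards [Measure.ae_ne volume (0 : E3)] with x hx
    rw [norm_mul, norm_mul, regGreen, norm_div, norm_div, norm_exp_I_mul_ofReal,
      norm_exp_I_mul_ofReal, Complex.norm_real, Complex.norm_real, norm_norm,
      Real.norm_of_nonneg (regNorm_pos hδ x).le]
    have := norm_pos_iff.2 hx
    gcongr
    exact norm_le_regNorm δ x
  · exact ((locallyIntegrable_exp_div_norm k).integrable_smul_right_of_hasCompactSupport hw hc).norm
  · filter_upwards [Measure.ae_ne volume (0 : E3)] with x hx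
    refine Filter.Tendsto.mul_const _ ?_
    have h : ContinuousAt (fun δ => regGreen k δ x) 0 := by
      unfold regGreen regNorm
      refine ContinuousAt.div (by fun_prop) (by fun_prop) ?_
      simp [hx]
    have h0 : regGreen k 0 x = Complex.exp (Complex.I * k * ‖x‖) / (‖x‖ : ℂ) := by
      simp [regGreen, regNorm]
    rw [← h0]
    exact h.mono_left nhdsWithin_le_nhds

/-- The factor `4π` is the source profile at zero, which is `3`, times the total weight `4π/3`. -/
theorem tendsto_integral_regSource_mul (k : ℝ) {w : E3 → ℂ} (hw : Continuous w)
    (hc : HasCompactSupport w) :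
    Filter.Tendsto (fun δ => ∫ y : E3, (regNorm 1 y ^ 5)⁻¹ •
      (regSource k (regNorm δ (δ • y)) * w (δ • y))) (𝓝[>] 0) (𝓝 (4 * Real.pi * w 0)) := by
  have hlim : ∫ y : E3, (regNorm 1 y ^ 5)⁻¹ • (3 * w 0) = 4 * Real.pi * w 0 := by
    rw [integral_smul_const, integral_inv_regNorm_pow_five, Complex.real_smul]
    push_cast
    ring
  -- The profile itself grows quadratically; a bound uniform in `δ` comes from compactness of `[0,1]
  -- × supp w`.
  obtain ⟨C, hC⟩ : ∃ C, ∀ δ ∈ Set.Icc (0 : ℝ) 1, ∀ x, ‖regSource k (regNorm δ x) * w x‖ ≤ C := by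
    have hcont : Continuous fun p : ℝ × E3 => ‖regSource k (regNorm p.1 p.2) * w p.2‖ :=
      (((continuous_regSource k).comp continuous_regNorm_uncurry).mul
        (hw.comp continuous_snd)).norm
    obtain ⟨C, hC⟩ := ((isCompact_Icc (a := (0 : ℝ)) (b := 1)).prod hc).bddAbove_image
      hcont.continuousOn
    refine ⟨max C 0, fun δ hδ x => ?_⟩
    by_cases hx : x ∈ tsupport w
    · exact (hC ⟨(δ, x), ⟨hδ, hx⟩, rfl⟩).trans (le_max_left _ _)
    · simp [image_eq_zero_of_notMem_tsupport hx]
  rw [← hlim]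
  refine tendsto_integral_filter_of_dominated_convergence
    (fun y : E3 => C * (regNorm 1 y ^ 5)⁻¹) ?_ ?_ ?_ ?_
  · have hm : Continuous fun y : E3 => (regNorm 1 y ^ 5)⁻¹ :=
      ((contDiff_regNorm one_pos (n := 0)).continuous.pow 5).inv₀ fun y =>
        (pow_pos (regNorm_pos one_pos y) 5).ne'
    filter_upwards [self_mem_nhdsWithin] with δ hδ
    have hδ' : Continuous fun y : E3 => δ • y := continuous_const_smul δ
    exact (hm.smul (((continuous_regSource k).comp
      ((contDiff_regNorm hδ (n := 0)).continuous.comp hδ')).mul (hw.comp hδ'))).aestronglyMeasurable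
  · filter_upwards [self_mem_nhdsWithin, mem_nhdsWithin_of_mem_nhds (Iic_mem_nhds one_pos)]
      with δ hδ hδ1
    refine Filter.Eventually.of_forall fun y => ?_
    have := regNorm_pos one_pos y
    rw [norm_smul, Real.norm_of_nonneg (by positivity), mul_comm]
    gcongr
    exact hC δ ⟨le_of_lt hδ, hδ1⟩ _
  · exact integrable_inv_regNorm_pow_five.const_mul C
  · refine Filter.Eventually.of_forall fun y => Filter.Tendsto.const_smul ?_ _
    have h : Continuous fun δ : ℝ => regSource k (regNorm δ (δ • y)) * w (δ • y) :=
      ((continuous_regSource k).comp (continuous_regNorm_uncurry.comp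
        (continuous_id.prodMk (continuous_id.smul continuous_const)))).mul
        (hw.comp (continuous_id.smul continuous_const))
    have h0 : regSource k (regNorm 0 ((0 : ℝ) • y)) * w ((0 : ℝ) • y) = 3 * w 0 := by
      simp [regSource, regNorm]
    rw [← h0]
    exact (h.tendsto 0).mono_left nhdsWithin_le_nhds

theorem integral_exp_div_norm_mul_helmholtz (k : ℝ) {w : E3 → ℂ} (hw : ContDiff ℝ 2 w)
    (hc : HasCompactSupport w) :
    ∫ x : E3, Complex.exp (Complex.I * k * ‖x‖) / (‖x‖ : ℂ) * helmholtz k w x =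
      -(4 * Real.pi * w 0) := by
  refine tendsto_nhds_unique (tendsto_integral_regGreen_mul k (helmholtz_continuous k hw)
    (hc.helmholtz k)) ((tendsto_integral_regSource_mul k hw.continuous hc).neg.congr' ?_)
  filter_upwards [self_mem_nhdsWithin] with δ hδ
  exact (integral_regGreen_mul_helmholtz k hδ hw hc).symm

theorem helmholtz_comp_add_left (k : ℝ) (w : E3 → ℂ) (y x : E3) :
    helmholtz k (fun z => w (y + z)) x = helmholtz k w (y + x) := by
  have h (i : Fin 3) (u : E3 → ℂ) :
      spderiv i (fun z => u (y + z)) = fun z => spderiv i u (y + z) := by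
    ext z
    simp only [spderiv, fderiv_comp_add_left]
  simp only [helmholtz, h]

/-- The function `g(·,y)` is a fundamental solution: `(Δ + k²) g(·,y) = -δ_y`. -/
theorem integral_green_mul_helmholtz (k : ℝ) (y : E3) {w : E3 → ℂ} (hw : ContDiff ℝ 2 w)
    (hc : HasCompactSupport w) :
    ∫ x, green k x y * helmholtz k w x = -w y := by
  have h := integral_exp_div_norm_mul_helmholtz k (w := fun z => w (y + z))
    (hw.comp (contDiff_const.add contDiff_id)) (hc.comp_homeomorph (Homeomorph.addLeft y))
  simp only [helmholtz_comp_add_left, add_zero] at h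
  rw [← integral_add_left_eq_self _ y]
  have h2 (x : E3) : green k (y + x) y * helmholtz k w (y + x) =
      (4 * Real.pi : ℂ)⁻¹ * (Complex.exp (Complex.I * k * ‖x‖) / (‖x‖ : ℂ) *
        helmholtz k w (y + x)) := by
    rw [green, add_sub_cancel_left]
    field_simp
  simp only [h2]
  rw [integral_const_mul, h]
  have : (Real.pi : ℂ) ≠ 0 := by exact_mod_cast Real.pi_ne_zero
  field_simp

/-! ### Volume potentials -/

/-- Differences of points of the bounded set `Ω` stay in a fixed ball, so the kernel may be cut off
to an integrable function of `x - y`. The integrand of a convolution of two integrable functions is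
integrable on the product. -/
theorem integrable_green_mul (k : ℝ) {Ω : Set E3} (hΩ : MeasurableSet Ω)
    (hΩb : Bornology.IsBounded Ω) {F : E3 → ℂ} (hF : IntegrableOn F Ω) :
    Integrable (fun p : E3 × E3 => green k p.1 p.2 * F p.2)
      ((volume.restrict Ω).prod (volume.restrict Ω)) := by
  obtain ⟨R, hR⟩ := Metric.isBounded_iff.1 hΩb
  let K : E3 → ℂ := fun z =>
    (4 * Real.pi : ℂ)⁻¹ * (Complex.exp (Complex.I * k * ‖z‖) / (‖z‖ : ℂ))
  have hK : Integrable ((Metric.closedBall (0 : E3) R).indicator K) := by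
    rw [integrable_indicator_iff Metric.isClosed_closedBall.measurableSet]
    exact ((locallyIntegrable_exp_div_norm k).integrableOn_isCompact
      (isCompact_closedBall _ _)).const_mul _
  have h := ((integrable_indicator_iff hΩ).2 hF).convolution_integrand
    (ContinuousLinearMap.mul ℝ ℂ) hK
  have h2 := h.integrableOn (s := Ω ×ˢ Ω)
  rw [IntegrableOn, ← Measure.prod_restrict] at h2
  refine h2.congr ?_
  rw [Measure.prod_restrict]
  refine (ae_restrict_iff' (hΩ.prod hΩ)).2 (Filter.Eventually.of_forall fun p hp => ?_)
  have hmem : p.1 - p.2 ∈ Metric.closedBall (0 : E3) R := by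
    rw [mem_closedBall_zero_iff, ← dist_eq_norm]
    exact hR hp.1 hp.2
  simp only [Set.indicator_of_mem hp.2, Set.indicator_of_mem hmem, ContinuousLinearMap.mul_apply',
    K, green]
  field_simp

theorem integrable_green_mul_mul (k : ℝ) {Ω : Set E3} (hΩ : MeasurableSet Ω)
    (hΩb : Bornology.IsBounded Ω) {F : E3 → ℂ} (hF : IntegrableOn F Ω) {w : E3 → ℂ}
    (hw : Continuous w) (hc : HasCompactSupport w) :
    Integrable (fun p : E3 × E3 => green k p.1 p.2 * F p.2 * w p.1)
      ((volume.restrict Ω).prod (volume.restrict Ω)) := by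
  obtain ⟨C, hC⟩ := hc.exists_bound_of_continuous hw
  exact (integrable_green_mul k hΩ hΩb hF).mul_bdd (c := C)
    (hw.comp continuous_fst).aestronglyMeasurable (Filter.Eventually.of_forall fun p => hC p.1)

/-- The volume potential with density `F` solves `(Δ + k²) V = -F` in the weak sense. -/
theorem setIntegral_potential_mul_helmholtz (k : ℝ) {Ω : Set E3} (hΩ : MeasurableSet Ω)
    (hΩb : Bornology.IsBounded Ω) {F : E3 → ℂ} (hF : IntegrableOn F Ω) {w : E3 → ℂ}
    (hw : ContDiff ℝ 2 w) (hc : HasCompactSupport w) (hs : tsupport w ⊆ Ω) :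
    ∫ x in Ω, (∫ y in Ω, green k x y * F y) * helmholtz k w x = -∫ y in Ω, F y * w y := by
  have hint := integrable_green_mul_mul k hΩ hΩb hF (helmholtz_continuous k hw) (hc.helmholtz k)
  simp only [← integral_mul_const]
  rw [integral_integral_swap hint, ← integral_neg]
  congr 1
  ext y
  have h1 (x : E3) : green k x y * F y * helmholtz k w x =
      F y * (green k x y * helmholtz k w x) := by ring
  simp only [h1]
  rw [integral_const_mul, setIntegral_eq_integral_of_forall_compl_eq_zero,
    integral_green_mul_helmholtz k y hw hc, mul_neg]
  intro x hx
  rw [image_eq_zero_of_notMem_tsupport fun h => hx (hs (tsupport_helmholtz_subset k w h)), mul_zero]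

theorem setIntegral_potential_dotProduct_helmholtz (k : ℝ) {Ω : Set E3} (hΩ : MeasurableSet Ω)
    (hΩb : Bornology.IsBounded Ω) {F : E3 → C3} (hF : IntegrableOn F Ω) {w : E3 → C3}
    (hw : ∀ j, ContDiff ℝ 2 fun x => w x j) (hc : ∀ j, HasCompactSupport fun x => w x j)
    (hs : ∀ j, tsupport (fun x => w x j) ⊆ Ω) (hFw : ∀ j, IntegrableOn (fun x => F x j * w x j) Ω) :
    ∫ x in Ω, potential k Ω F x ⬝ᵥ (fun j => helmholtz k (fun y => w y j) x) =
      -∫ x in Ω, F x ⬝ᵥ w x := by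
  have hFj (j : Fin 3) : IntegrableOn (fun x => F x j) Ω := hF.eval j
  -- Components commute with the vector integral where each component is integrable in `y`; Fubini
  -- guarantees this for almost every `x`, which suffices.
  have hae : ∀ᵐ x ∂volume.restrict Ω, ∀ j, potential k Ω F x j = ∫ y in Ω, green k x y * F y j := by
    have h := fun j => (integrable_green_mul k hΩ hΩb (hFj j)).prod_right_ae
    filter_upwards [ae_all_iff.2 h] with x hx j
    exact eval_integral (fun i => hx i) j
  have hintj (j : Fin 3) : Integrable (fun x => (∫ y in Ω, green k x y * F y j) *
      helmholtz k (fun y => w y j) x) (volume.restrict Ω) := by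
    simpa only [integral_mul_const] using (integrable_green_mul_mul k hΩ hΩb (hFj j)
      (helmholtz_continuous k (hw j)) ((hc j).helmholtz k)).integral_prod_left
  calc _ = ∫ x in Ω, ∑ j, (∫ y in Ω, green k x y * F y j) * helmholtz k (fun y => w y j) x := by
        refine integral_congr_ae ?_
        filter_upwards [hae] with x hx
        simp only [dotProduct, hx]
    _ = ∑ j, -∫ x in Ω, F x j * w x j := by
        rw [integral_finsetSum _ fun j _ => hintj j]
        exact Finset.sum_congr rfl fun j _ =>
          setIntegral_potential_mul_helmholtz k hΩ hΩb (hFj j) (hw j) (hc j) (hs j)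
    _ = _ := by
        rw [Finset.sum_neg_distrib, ← integral_finsetSum _ fun j _ => hFw j]
        rfl

/-! ### Components of the curl -/

theorem pderiv_apply {F : E3 → C3} {x : E3} (hF : DifferentiableAt ℝ F x) (i j : Fin 3) :
    pderiv i F x j = spderiv i (fun y => F y j) x := by
  rw [pderiv, spderiv, fderiv_apply hF]
  rfl

theorem curl_eq {F : E3 → C3} {x : E3} (hF : DifferentiableAt ℝ F x) :
    curl F x = ![spderiv 1 (fun y => F y 2) x - spderiv 2 (fun y => F y 1) x,
      spderiv 2 (fun y => F y 0) x - spderiv 0 (fun y => F y 2) x,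
      spderiv 0 (fun y => F y 1) x - spderiv 1 (fun y => F y 0) x] := by
  simp only [curl, pderiv_apply hF]

theorem ContDiffOn.curl {m n : WithTop ℕ∞} {Ω : Set E3} {F : E3 → C3} (hF : ContDiffOn ℝ n F Ω)
    (hΩ : IsOpen Ω) (h : m + 1 ≤ n) : ContDiffOn ℝ m (curl F) Ω := by
  have hp (i j : Fin 3) : ContDiffOn ℝ m (fun x => pderiv i F x j) Ω :=
    contDiffOn_pi.1 ((hF.fderiv_of_isOpen hΩ h).clm_apply contDiffOn_const) j
  refine contDiffOn_pi.2 fun j => ?_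
  fin_cases j
  · exact (hp 1 2).sub (hp 2 1)
  · exact (hp 2 0).sub (hp 0 2)
  · exact (hp 0 1).sub (hp 1 0)

theorem ContDiff.curl {m n : WithTop ℕ∞} {F : E3 → C3} (hF : ContDiff ℝ n F) (h : m + 1 ≤ n) :
    ContDiff ℝ m (curl F) :=
  contDiffOn_univ.1 (hF.contDiffOn.curl isOpen_univ h)

theorem ContDiffOn.component {n : WithTop ℕ∞} {Ω : Set E3} {F : E3 → C3} (hF : ContDiffOn ℝ n F Ω)
    (j : Fin 3) : ContDiffOn ℝ n (fun x => F x j) Ω :=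
  contDiffOn_pi.1 hF j

theorem ContDiff.component {n : WithTop ℕ∞} {F : E3 → C3} (hF : ContDiff ℝ n F) (j : Fin 3) :
    ContDiff ℝ n fun x => F x j :=
  contDiff_pi.1 hF j

theorem HasCompactSupport.component {F : E3 → C3} (hF : HasCompactSupport F) (j : Fin 3) :
    HasCompactSupport fun x => F x j :=
  hF.comp_left (g := fun v : C3 => v j) rfl

theorem tsupport_component_subset (F : E3 → C3) (j : Fin 3) :
    tsupport (fun x => F x j) ⊆ tsupport F :=
  tsupport_comp_subset (g := fun v : C3 => v j) rfl F

theorem tsupport_curl_subset (F : E3 → C3) : tsupport (curl F) ⊆ tsupport F := by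
  refine closure_minimal (fun x hx => ?_) (isClosed_tsupport F)
  by_contra hxF
  refine hx ?_
  have h : fderiv ℝ F x = 0 := image_eq_zero_of_notMem_tsupport fun h =>
    hxF (tsupport_fderiv_subset ℝ h)
  ext j
  fin_cases j <;> simp [curl, pderiv, h]

theorem HasCompactSupport.curl {F : E3 → C3} (hF : HasCompactSupport F) :
    HasCompactSupport (curl F) :=
  hF.of_isClosed_subset (isClosed_tsupport _) (tsupport_curl_subset F)

theorem integrable_dotProduct_of_tsupport_subset {Ω : Set E3} {F w : E3 → C3}
    (hF : ContinuousOn F Ω) (hw : Continuous w) (hc : HasCompactSupport w) (hs : tsupport w ⊆ Ω) :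
    Integrable fun x => F x ⬝ᵥ w x :=
  integrable_finsetSum _ fun j _ => integrable_mul_of_tsupport_subset
    (continuousOn_pi.1 hF j) (continuous_pi_iff.1 hw j) (hc.component j)
    ((tsupport_component_subset w j).trans hs)

theorem setIntegral_dotProduct_of_tsupport_subset {Ω : Set E3} (F : E3 → C3) {w : E3 → C3}
    (hs : tsupport w ⊆ Ω) : ∫ x in Ω, F x ⬝ᵥ w x = ∫ x, F x ⬝ᵥ w x := by
  refine setIntegral_eq_integral_of_forall_compl_eq_zero fun x hx => ?_
  rw [image_eq_zero_of_notMem_tsupport fun h => hx (hs h), dotProduct_zero]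

theorem integral_sub_add_sub_add_sub {a b c d e f : E3 → ℂ} (ha : Integrable a) (hb : Integrable b)
    (hc : Integrable c) (hd : Integrable d) (he : Integrable e) (hf : Integrable f) :
    ∫ x, ((a x - b x) + (c x - d x) + (e x - f x)) =
      ((∫ x, a x) - ∫ x, b x) + ((∫ x, c x) - ∫ x, d x) + ((∫ x, e x) - ∫ x, f x) := by
  have h1 : Integrable fun x => a x - b x := ha.sub hb
  have h2 : Integrable fun x => c x - d x := hc.sub hd
  have h3 : Integrable fun x => e x - f x := he.sub hf
  have h4 : Integrable fun x => (a x - b x) + (c x - d x) := h1.add h2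
  rw [← integral_sub ha hb, ← integral_sub hc hd, ← integral_sub he hf, ← integral_add h1 h2,
    ← integral_add h4 h3]

/-- The classical curl of a continuously differentiable field is its weak curl. -/
theorem isWeakCurlOn_curl {Ω : Set E3} (hΩ : IsOpen Ω) {F : E3 → C3}
    (hF : ContDiffOn ℝ 1 F Ω) : IsWeakCurlOn Ω F (curl F) := by
  intro φ hφ hc hs
  have hφ1 : ContDiff ℝ 1 φ := hφ.of_le (by exact_mod_cast le_top)
  rw [setIntegral_dotProduct_of_tsupport_subset _ ((tsupport_curl_subset φ).trans hs),
    setIntegral_dotProduct_of_tsupport_subset _ hs]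
  have hsj (j : Fin 3) : tsupport (fun x => φ x j) ⊆ Ω := (tsupport_component_subset φ j).trans hs
  have hparts (i j l : Fin 3) : ∫ x, F x j * spderiv i (fun y => φ y l) x =
      -∫ x, spderiv i (fun y => F y j) x * φ x l :=
    integral_mul_spderiv hΩ (hF.component j) (hφ1.component l) (hc.component l) (hsj l) i
  have hA (i j l : Fin 3) : Integrable fun x => F x j * spderiv i (fun y => φ y l) x :=
    integrable_mul_of_tsupport_subset (hF.component j).continuousOn
      ((hφ1.component l).spderiv (m := 0) (by simp) i).continuous ((hc.component l).spderiv i)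
      ((tsupport_spderiv_subset _ _).trans (hsj l))
  have hB (i j l : Fin 3) : Integrable fun x => spderiv i (fun y => F y j) x * φ x l :=
    integrable_mul_of_tsupport_subset
      ((hF.component j).spderiv hΩ (m := 0) (by simp) i).continuousOn
      (hφ1.component l).continuous (hc.component l) (hsj l)
  have hL (x : E3) : F x ⬝ᵥ curl φ x =
      (F x 0 * spderiv 1 (fun y => φ y 2) x - F x 0 * spderiv 2 (fun y => φ y 1) x) +
      (F x 1 * spderiv 2 (fun y => φ y 0) x - F x 1 * spderiv 0 (fun y => φ y 2) x) +
      (F x 2 * spderiv 0 (fun y => φ y 1) x - F x 2 * spderiv 1 (fun y => φ y 0) x) := by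
    rw [curl_eq (hφ1.differentiable one_ne_zero x)]
    simp [dotProduct, Fin.sum_univ_three]
    ring
  have hR (x : E3) : curl F x ⬝ᵥ φ x =
      (spderiv 1 (fun y => F y 2) x * φ x 0 - spderiv 2 (fun y => F y 1) x * φ x 0) +
      (spderiv 2 (fun y => F y 0) x * φ x 1 - spderiv 0 (fun y => F y 2) x * φ x 1) +
      (spderiv 0 (fun y => F y 1) x * φ x 2 - spderiv 1 (fun y => F y 0) x * φ x 2) := by
    -- Off the support of `φ` the field `F` may fail to be differentiable, but both sides vanish.
    by_cases hx : x ∈ tsupport φ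
    · rw [curl_eq ((hF.contDiffAt (hΩ.mem_nhds (hs hx))).differentiableAt one_ne_zero)]
      simp [dotProduct, Fin.sum_univ_three]
      ring
    · simp [image_eq_zero_of_notMem_tsupport hx]
  simp only [hL, hR]
  rw [integral_sub_add_sub_add_sub (hA 1 0 2) (hA 2 0 1) (hA 2 1 0) (hA 0 1 2) (hA 0 2 1)
      (hA 1 2 0),
    integral_sub_add_sub_add_sub (hB 1 2 0) (hB 2 1 0) (hB 2 0 1) (hB 0 2 1) (hB 0 1 2)
      (hB 1 0 2)]
  simp only [hparts]
  ring

/-! ### The double curl of a solenoidal field -/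

theorem spderiv_comm {u : E3 → ℂ} (hu : ContDiff ℝ 2 u) (i j : Fin 3) :
    spderiv i (spderiv j u) = spderiv j (spderiv i u) := by
  ext x
  have hd : DifferentiableAt ℝ (fderiv ℝ u) x :=
    (hu.fderiv_right (m := 1) (by norm_num)).differentiable one_ne_zero x
  have h (i j : Fin 3) : spderiv i (spderiv j u) x =
      fderiv ℝ (fderiv ℝ u) x (EuclideanSpace.single i 1) (EuclideanSpace.single j 1) := by
    unfold spderiv
    rw [fderiv_clm_apply hd (differentiableAt_const _)]
    simp
  rw [h, h]
  exact hu.contDiffAt.isSymmSndFDerivAt (by simp) _ _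

theorem spderiv_sub {u v : E3 → ℂ} (hu : Differentiable ℝ u) (hv : Differentiable ℝ v)
    (i : Fin 3) : spderiv i (fun x => u x - v x) = fun x => spderiv i u x - spderiv i v x := by
  ext x
  unfold spderiv
  rw [fderiv_fun_sub (hu x) (hv x)]
  rfl

/-- `∇ × ∇ × ψ = -Δψ` for a curl `ψ = ∇ × φ`. -/
theorem curl_curl_curl {φ : E3 → C3} (hφ : ContDiff ℝ 3 φ) (k : ℝ) (x : E3) :
    curl (curl (curl φ)) x = (k : ℂ) ^ 2 • curl φ x -
      fun j => helmholtz k (fun y => curl φ y j) x := by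
  have h1 : ContDiff ℝ 2 (curl φ) := hφ.curl (by norm_num)
  have h2 : ContDiff ℝ 1 (curl (curl φ)) := h1.curl (by norm_num)
  have hφj (j : Fin 3) : ContDiff ℝ 3 fun y => φ y j := hφ.component j
  have hd (i j : Fin 3) : ContDiff ℝ 2 (spderiv i fun y => φ y j) :=
    (hφj j).spderiv (by norm_num) i
  have hd' (i j : Fin 3) : Differentiable ℝ (spderiv i fun y => φ y j) :=
    (hd i j).differentiable two_ne_zero
  have hdd (i l j : Fin 3) : Differentiable ℝ (spderiv i (spderiv l fun y => φ y j)) :=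
    ((hd l j).spderiv (m := 1) (by norm_num) i).differentiable one_ne_zero
  have c0 : (fun y => curl φ y 0) =
      fun y => spderiv 1 (fun y => φ y 2) y - spderiv 2 (fun y => φ y 1) y := by
    ext y
    rw [curl_eq (hφ.differentiable (by norm_num) y)]
    rfl
  have c1 : (fun y => curl φ y 1) =
      fun y => spderiv 2 (fun y => φ y 0) y - spderiv 0 (fun y => φ y 2) y := by
    ext y
    rw [curl_eq (hφ.differentiable (by norm_num) y)]
    rfl
  have c2 : (fun y => curl φ y 2) =
      fun y => spderiv 0 (fun y => φ y 1) y - spderiv 1 (fun y => φ y 0) y := by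
    ext y
    rw [curl_eq (hφ.differentiable (by norm_num) y)]
    rfl
  have hcc (j : Fin 3) : (fun y => curl (curl φ) y j) = fun y =>
      ![spderiv 1 (fun y => curl φ y 2) y - spderiv 2 (fun y => curl φ y 1) y,
      spderiv 2 (fun y => curl φ y 0) y - spderiv 0 (fun y => curl φ y 2) y,
      spderiv 0 (fun y => curl φ y 1) y - spderiv 1 (fun y => curl φ y 0) y] j := by
    ext y
    rw [curl_eq (h1.differentiable two_ne_zero y)]
  rw [curl_eq (h2.differentiable one_ne_zero x), hcc 0, hcc 1, hcc 2]
  have hswap (i l j : Fin 3) : spderiv i (spderiv l fun y => φ y j) =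
      spderiv l (spderiv i fun y => φ y j) := spderiv_comm ((hφj j).of_le (by norm_num)) i l
  have hswap' (a i l j : Fin 3) : spderiv a (spderiv i (spderiv l fun y => φ y j)) =
      spderiv i (spderiv a (spderiv l fun y => φ y j)) := spderiv_comm (hd l j) a i
  ext j
  fin_cases j <;>
  · simp [helmholtz, Fin.sum_univ_three, c0, c1, c2, spderiv_sub, hd', hdd]
    -- Sorting the indices of the third derivatives makes the terms of `∇(∇·(∇×φ))` cancel.
    simp only [hswap 1 0, hswap 2 0, hswap 2 1, hswap' 1 0, hswap' 2 0, hswap' 2 1]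
    ring

/-! ### Algebra of the curl -/

theorem curl_congr_of_eventuallyEq {F G : E3 → C3} {x : E3} (h : F =ᶠ[𝓝 x] G) :
    curl F x = curl G x := by
  simp only [curl, pderiv, h.fderiv_eq]

theorem curl_smul {f : E3 → ℂ} {F : E3 → C3} {x : E3} (hf : DifferentiableAt ℝ f x)
    (hF : DifferentiableAt ℝ F x) :
    curl (fun y => f y • F y) x = cgrad f x ⨯₃ F x + f x • curl F x := by
  have h (i j : Fin 3) : pderiv i (fun y => f y • F y) x j =
      f x * pderiv i F x j + cgrad f x i * F x j := by
    rw [pderiv, fderiv_fun_smul hf hF]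
    rfl
  simp only [curl, h, cross_apply]
  ext j
  fin_cases j <;> simp <;> ring

theorem hasFDerivAt_cexp_inner (k : ℝ) (α x : E3) :
    HasFDerivAt (fun y : E3 => Complex.exp (Complex.I * k * (inner ℝ α y : ℝ)))
      (Complex.exp (Complex.I * k * (inner ℝ α x : ℝ)) •
        ((Complex.I * k) • (Complex.ofRealCLM.comp (innerSL ℝ α)))) x :=
  (((Complex.ofRealCLM.comp (innerSL ℝ α)).hasFDerivAt (x := x)).const_mul (Complex.I * k)).cexp

theorem contDiff_planeWave (k : ℝ) (α : E3) (A : C3) {n : WithTop ℕ∞} :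
    ContDiff ℝ n (planeWave k α A) := by
  have h : ContDiff ℝ n fun y : E3 => ((inner ℝ α y : ℝ) : ℂ) :=
    (Complex.ofRealCLM.comp (innerSL ℝ α)).contDiff
  exact (contDiff_const.mul h).cexp.smul contDiff_const

theorem curl_planeWave (k : ℝ) (α : E3) (A : C3) :
    curl (planeWave k α A) =
      planeWave k α ((Complex.I * k) • ((fun i => (α i : ℂ)) ⨯₃ A)) := by
  ext x : 1
  have h := hasFDerivAt_cexp_inner k α x
  have hg : cgrad (fun y : E3 => Complex.exp (Complex.I * k * (inner ℝ α y : ℝ))) x =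
      (Complex.exp (Complex.I * k * (inner ℝ α x : ℝ)) * (Complex.I * k)) •
        fun i => (α i : ℂ) := by
    ext i
    rw [cgrad, h.fderiv]
    simp [EuclideanSpace.inner_single_right]
    ring
  have hc : curl (fun _ : E3 => A) x = 0 := by
    ext j
    fin_cases j <;> simp [curl, pderiv]
  change curl (fun y => Complex.exp (Complex.I * k * (inner ℝ α y : ℝ)) • (fun _ : E3 => A) y) x = _
  rw [curl_smul h.differentiableAt (differentiableAt_const A), hc, hg, smul_zero, add_zero,
    planeWave, map_smul, LinearMap.smul_apply, smul_smul]

/-- A transversal plane wave solves `∇ × ∇ × E₀ = k² E₀`. -/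
theorem curl_curl_planeWave (k : ℝ) {α : E3} (hα : ‖α‖ = 1) {A : C3}
    (hA : (A ⬝ᵥ fun i => (α i : ℂ)) = 0) (x : E3) :
    curl (curl (planeWave k α A)) x = (k : ℂ) ^ 2 • planeWave k α A x := by
  have h1 : ((fun i => (α i : ℂ)) ⬝ᵥ fun i => (α i : ℂ)) = 1 := by
    rw [EuclideanSpace.norm_eq, Real.sqrt_eq_one] at hα
    simp only [Real.norm_eq_abs, sq_abs] at hα
    simp only [dotProduct, ← pow_two]
    exact_mod_cast hα
  -- By transversality `α × (α × 𝓔) = -𝓔`, and `(ik)² · (-1) = k²`.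
  rw [curl_planeWave, curl_planeWave, map_smul, cross_cross_eq_smul_sub_smul', h1,
    dotProduct_comm, hA, planeWave, planeWave]
  ext j
  simp
  linear_combination (-Complex.exp (Complex.I * k * (inner ℝ α x : ℝ)) * k ^ 2 * A j) *
    Complex.I_sq

/-! ### From the weak to the strong curl -/

/-- The classical curl is also a weak curl. Testing the difference with scalar bumps in each
coordinate direction shows that it vanishes almost everywhere, hence everywhere in `Ω` by
continuity. -/
theorem IsWeakCurlOn.eqOn_curl {Ω : Set E3} (hΩ : IsOpen Ω) {F G : E3 → C3}
    (h : IsWeakCurlOn Ω F G) (hF : ContDiffOn ℝ 1 F Ω) (hG : ContinuousOn G Ω) :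
    Set.EqOn (curl F) G Ω := by
  have hcF : ContinuousOn (curl F) Ω := (hF.curl hΩ (m := 0) (by simp)).continuousOn
  intro x hx
  ext j
  have hcj : ContinuousOn (fun x => curl F x j - G x j) Ω :=
    (continuousOn_pi.1 hcF j).sub (continuousOn_pi.1 hG j)
  have hae := hΩ.ae_eq_zero_of_integral_contDiff_smul_eq_zero (μ := volume)
    (hcj.locallyIntegrableOn hΩ.measurableSet) fun g hg hgc hgs => by
    let φ : E3 → C3 := fun y => Pi.single j (g y : ℂ)
    have hφ : ContDiff ℝ ((⊤ : ℕ∞) : WithTop ℕ∞) φ := by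
      refine contDiff_pi.2 fun i => ?_
      by_cases hij : i = j
      · subst hij
        simp only [φ, Pi.single_eq_same]
        exact Complex.ofRealCLM.contDiff.comp hg
      · simpa [φ, hij] using contDiff_const
    have hts : tsupport φ ⊆ tsupport g :=
      tsupport_comp_subset (g := fun r : ℝ => (Pi.single j (r : ℂ) : C3)) (by simp) g
    have hφc : HasCompactSupport φ := hgc.of_isClosed_subset (isClosed_tsupport _) hts
    have hφs := hts.trans hgs
    have h1 := (isWeakCurlOn_curl hΩ hF φ hφ hφc hφs).symm.trans (h φ hφ hφc hφs)
    rw [setIntegral_dotProduct_of_tsupport_subset _ hφs,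
      setIntegral_dotProduct_of_tsupport_subset _ hφs, ← sub_eq_zero,
      ← integral_sub
        (integrable_dotProduct_of_tsupport_subset hcF hφ.continuous hφc hφs)
        (integrable_dotProduct_of_tsupport_subset hG hφ.continuous hφc hφs)] at h1
    rw [← h1]
    congr 1
    ext y
    simp [φ, mul_comm, mul_sub]
  have := Measure.eqOn_open_of_ae_eq ((ae_restrict_iff' hΩ.measurableSet).2 hae) hΩ hcj
    continuousOn_const hx
  exact sub_eq_zero.1 this

/-! ### The limiting medium -/

theorem continuousOn_density {Ω : Set E3} (hΩ : IsOpen Ω) {h : E3 → ℂ} (hh : ContinuousOn h Ω)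
    {N : E3 → ℝ} (hN : ContinuousOn N Ω) (τ : Matrix (Fin 3) (Fin 3) ℝ) {E : E3 → C3}
    (hE : ContDiffOn ℝ 1 E Ω) : ContinuousOn (density h N τ E) Ω := by
  have hc : ContinuousOn (curl E) Ω := (hE.curl hΩ (m := 0) (by simp)).continuousOn
  have hM : Continuous fun v : C3 => τ.map (fun r : ℝ => (r : ℂ)) *ᵥ v :=
    continuous_const.matrix_mulVec continuous_id
  exact (hh.mul (Complex.continuous_ofReal.comp_continuousOn hN)).smul (hM.comp_continuousOn hc)

/-- A limiting field satisfies `∇ × (∇ × E + (c₀/(iωμ)) h N τ ∇ × E) = k² E` in the sense of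
distributions. -/
theorem IsLimitingField.isWeakCurlOn {ω ε μ c₀ : ℝ} {Ω : Set E3} (hΩ : IsOpen Ω)
    (hΩb : Bornology.IsBounded Ω) {h : E3 → ℂ} (hh : ContinuousOn h Ω) {N : E3 → ℝ}
    (hN : ContinuousOn N Ω) {τ : Matrix (Fin 3) (Fin 3) ℝ} {α : E3} (hα : ‖α‖ = 1) {A : C3}
    (hA : (A ⬝ᵥ fun i => (α i : ℂ)) = 0) {E : E3 → C3}
    (hE : IsLimitingField ω ε μ c₀ Ω h N τ (planeWave (waveNumber ω ε μ) α A) E) :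
    IsWeakCurlOn Ω
      (fun x => curl E x + ((c₀ : ℂ) / (Complex.I * ω * μ)) • density h N τ E x)
      (fun x => (waveNumber ω ε μ : ℂ) ^ 2 • E x) := by
  set k := waveNumber ω ε μ
  set c : ℂ := (c₀ : ℂ) / (Complex.I * ω * μ)
  set F := density h N τ E
  set V := potential k Ω F
  set E₀ := planeWave k α A
  have hEc := hE.contDiffOn
  have hVc : ContDiffOn ℝ 1 V Ω := hE.contDiffOn_potential
  have hE₀c : ContDiff ℝ 2 E₀ := contDiff_planeWave k α A
  have hFc : ContinuousOn F Ω := continuousOn_density hΩ hh hN τ hEc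
  have hcE : ContinuousOn (curl E) Ω := (hEc.curl hΩ (m := 0) (by simp)).continuousOn
  have hcV : ContinuousOn (curl V) Ω := (hVc.curl hΩ (m := 0) (by simp)).continuousOn
  have hcurlE₀ : ContDiff ℝ 1 (curl E₀) := hE₀c.curl (by norm_num)
  intro φ hφ hφc hφs
  have htop : ((⊤ : ℕ∞) : WithTop ℕ∞) + 1 ≤ ((⊤ : ℕ∞) : WithTop ℕ∞) := by simp
  have hle (n : ℕ) : ((n : ℕ∞) : WithTop ℕ∞) ≤ ((⊤ : ℕ∞) : WithTop ℕ∞) := by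
    exact_mod_cast le_top
  set ψ := curl φ with hψdef
  have hψ : ContDiff ℝ ((⊤ : ℕ∞) : WithTop ℕ∞) ψ := hφ.curl htop
  have hψc : HasCompactSupport ψ := hφc.curl
  have hψs : tsupport ψ ⊆ Ω := (tsupport_curl_subset φ).trans hφs
  have hχ : ContDiff ℝ ((⊤ : ℕ∞) : WithTop ℕ∞) (curl ψ) := hψ.curl htop
  have hχc : HasCompactSupport (curl ψ) := hψc.curl
  have hχs : tsupport (curl ψ) ⊆ Ω := (tsupport_curl_subset ψ).trans hψs
  have hint {G w : E3 → C3} (hG : ContinuousOn G Ω)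
      (hw : ContDiff ℝ ((⊤ : ℕ∞) : WithTop ℕ∞) w) (hc : HasCompactSupport w) (hs : tsupport w ⊆ Ω) :
      IntegrableOn (fun x => G x ⬝ᵥ w x) Ω :=
    (integrable_dotProduct_of_tsupport_subset hG hw.continuous hc hs).integrableOn
  -- The integral equation tested against `w`; it is used with `w = ∇×∇×φ` and `w = φ`.
  have hsplit {w : E3 → C3} (hw : ContDiff ℝ ((⊤ : ℕ∞) : WithTop ℕ∞) w)
      (hc : HasCompactSupport w) (hs : tsupport w ⊆ Ω) :
      ∫ x in Ω, E x ⬝ᵥ w x = (∫ x in Ω, E₀ x ⬝ᵥ w x) - c * ∫ x in Ω, curl V x ⬝ᵥ w x := by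
    rw [← integral_const_mul, ← integral_sub (hint hE₀c.continuous.continuousOn hw hc hs)
      ((hint hcV hw hc hs).const_mul c)]
    refine setIntegral_congr_fun hΩ.measurableSet fun x hx => ?_
    simp only [hE.equation x hx, sub_dotProduct, smul_dotProduct, smul_eq_mul]
    rfl
  have e1 := isWeakCurlOn_curl hΩ hEc ψ hψ hψc hψs
  have e2 := hsplit hχ hχc hχs
  have e3 := hsplit hφ hφc hφs
  have e4 := isWeakCurlOn_curl hΩ (hE₀c.of_le one_le_two).contDiffOn ψ hψ hψc hψs
  have e5 := isWeakCurlOn_curl hΩ hcurlE₀.contDiffOn φ hφ hφc hφs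
  have e6 := isWeakCurlOn_curl hΩ hVc (curl ψ) hχ hχc hχs
  have e7 : ∫ x in Ω, V x ⬝ᵥ ψ x = ∫ x in Ω, curl V x ⬝ᵥ φ x :=
    isWeakCurlOn_curl hΩ hVc φ hφ hφc hφs
  have e8 : ∫ x in Ω, V x ⬝ᵥ (fun j => helmholtz k (fun y => ψ y j) x) =
      -∫ x in Ω, F x ⬝ᵥ ψ x := setIntegral_potential_dotProduct_helmholtz k hΩ.measurableSet hΩb hE.integrableOn
    (w := ψ) (fun j => (hψ.of_le (hle 2)).component j) (fun j => hψc.component j)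
    (fun j => (tsupport_component_subset ψ j).trans hψs)
    (fun j => (integrable_mul_of_tsupport_subset (continuousOn_pi.1 hFc j)
      (hψ.component j).continuous (hψc.component j)
      ((tsupport_component_subset ψ j).trans hψs)).integrableOn)
  have e9 : ∫ x in Ω, V x ⬝ᵥ (fun j => helmholtz k (fun y => ψ y j) x) =
      k ^ 2 * (∫ x in Ω, V x ⬝ᵥ ψ x) - ∫ x in Ω, V x ⬝ᵥ curl (curl ψ) x := by
    have hχ2 : ContDiff ℝ ((⊤ : ℕ∞) : WithTop ℕ∞) (curl (curl ψ)) := hχ.curl htop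
    rw [← integral_const_mul, ← integral_sub
      ((hint hVc.continuousOn hψ hψc hψs).const_mul _)
      (hint hVc.continuousOn hχ2 hχc.curl ((tsupport_curl_subset _).trans hχs))]
    congr 1
    ext x
    rw [hψdef, curl_curl_curl (hφ.of_le (hle 3)) k x, dotProduct_sub, dotProduct_smul, smul_eq_mul,
      sub_sub_cancel]
  have e10 : ∫ x in Ω, curl (curl E₀) x ⬝ᵥ φ x = k ^ 2 * ∫ x in Ω, E₀ x ⬝ᵥ φ x := by
    rw [← integral_const_mul]
    congr 1
    ext x
    rw [curl_curl_planeWave k hα hA, smul_dotProduct, smul_eq_mul]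
  have e11 : ∫ x in Ω, (curl E x + c • F x) ⬝ᵥ ψ x =
      (∫ x in Ω, curl E x ⬝ᵥ ψ x) + c * ∫ x in Ω, F x ⬝ᵥ ψ x := by
    rw [← integral_const_mul, ← integral_add (hint hcE hψ hψc hψs)
      ((hint hFc hψ hψc hψs).const_mul c)]
    simp only [add_dotProduct, smul_dotProduct, smul_eq_mul]
  have e12 : ∫ x in Ω, ((k : ℂ) ^ 2 • E x) ⬝ᵥ φ x = k ^ 2 * ∫ x in Ω, E x ⬝ᵥ φ x := by
    rw [← integral_const_mul]
    simp only [smul_dotProduct, smul_eq_mul]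
  rw [e11, e12]
  -- The plane wave contributes `k² ∫ E₀·φ` and the potential contributes `-c k² ∫ (∇×V)·φ - c ∫
  -- F·ψ`. By `e3` the two `k²` terms combine to `k² ∫ E·φ`.
  linear_combination -e1 + e2 - (k : ℂ) ^ 2 * e3 + e4 + e5 + e10 + c * e6 - c * k ^ 2 * e7 -
    c * e9 + c * e8

theorem waveNumber_sq {ω ε μ : ℝ} (hε : 0 < ε) (hμ : 0 < μ) :
    (waveNumber ω ε μ : ℂ) ^ 2 = (ω : ℂ) ^ 2 * ε * μ := by
  have h : waveNumber ω ε μ ^ 2 = ω ^ 2 * ε * μ := by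
    rw [waveNumber, mul_pow, Real.sq_sqrt (by positivity), mul_assoc]
  exact_mod_cast h

/-- This is where the isotropy of the tensor enters: the density becomes a scalar multiple of `∇×E`,
so its effect is absorbed in the permeability. -/
theorem curl_add_density {ω μ c₀ : ℝ} (h : E3 → ℂ) (N : E3 → ℝ) (E : E3 → C3) (x : E3) :
    curl E x + ((c₀ : ℂ) / (Complex.I * ω * μ)) •
        density h N ((2 / 3 : ℝ) • (1 : Matrix (Fin 3) (Fin 3) ℝ)) E x =
      mediumFactor ω μ c₀ h N x • curl E x := by
  have hτ : ((2 / 3 : ℝ) • (1 : Matrix (Fin 3) (Fin 3) ℝ)).map (fun r : ℝ => (r : ℂ)) =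
      (2 / 3 : ℂ) • 1 := by
    ext i j
    by_cases hij : i = j
    · subst hij
      simp
    · simp [hij]
  rw [density, hτ, Matrix.smul_mulVec, Matrix.one_mulVec, smul_smul, smul_smul, mediumFactor,
    add_smul, one_smul]
  congr 2
  ring

theorem continuousOn_mediumFactor {ω μ c₀ : ℝ} {Ω : Set E3} {h : E3 → ℂ} {N : E3 → ℝ}
    (hh : ContinuousOn h Ω) (hN : ContinuousOn N Ω) :
    ContinuousOn (mediumFactor ω μ c₀ h N) Ω :=
  continuousOn_const.add (continuousOn_const.mul
    (hh.mul (Complex.continuous_ofReal.comp_continuousOn hN)))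

/-- The magnetic field `H = ∇ × E / (iω m)` in a medium with permeability `m`. -/
noncomputable def magneticField (ω : ℝ) (m : E3 → ℂ) (E : E3 → C3) (x : E3) : C3 :=
  (Complex.I * ω * m x)⁻¹ • curl E x

/-- Faraday's law holds by the choice of `H`. Ampère's law is the weak equation for `d ∇×E` divided
by `iωμ`, since `k²/(iωμ) = -iωε`; no derivative of `h N` is involved. -/
theorem IsLimitingField.isMaxwellField {ω ε μ c₀ : ℝ} (hω : 0 < ω) (hε : 0 < ε) (hμ : 0 < μ)
    {Ω : Set E3} (hΩ : IsOpen Ω)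
    (hΩb : Bornology.IsBounded Ω) {h : E3 → ℂ} (hh : ContinuousOn h Ω) {N : E3 → ℝ}
    (hN : ContinuousOn N Ω) (hd : ∀ x ∈ Ω, mediumFactor ω μ c₀ h N x ≠ 0)
    {α : E3} (hα : ‖α‖ = 1) {A : C3}
    (hA : (A ⬝ᵥ fun i => (α i : ℂ)) = 0) {E : E3 → C3}
    (hE : IsLimitingField ω ε μ c₀ Ω h N ((2 / 3 : ℝ) • (1 : Matrix (Fin 3) (Fin 3) ℝ))
      (planeWave (waveNumber ω ε μ) α A) E) :
    IsMaxwellField ω ε Ω (limitPermeability ω μ c₀ h N) E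
      (magneticField ω (limitPermeability ω μ c₀ h N) E) := by
  have hω' : (ω : ℂ) ≠ 0 := by exact_mod_cast hω.ne'
  have hμ' : (μ : ℂ) ≠ 0 := by exact_mod_cast hμ.ne'
  have hI := Complex.I_ne_zero
  have hm (x : E3) (hx : x ∈ Ω) : limitPermeability ω μ c₀ h N x ≠ 0 := div_ne_zero hμ' (hd x hx)
  refine ⟨hE.contDiffOn, ?_, ?_, ?_⟩
  · refine ContinuousOn.smul (ContinuousOn.inv₀ (continuousOn_const.mul
      (continuousOn_const.div (continuousOn_mediumFactor hh hN) hd)) fun x hx => ?_)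
      (hE.contDiffOn.curl hΩ (m := 0) (by simp)).continuousOn
    exact mul_ne_zero (mul_ne_zero hI hω') (hm x hx)
  · intro x hx
    rw [magneticField, smul_inv_smul₀ (mul_ne_zero (mul_ne_zero hI hω') (hm x hx))]
  · intro φ hφ hφc hφs
    have hw := hE.isWeakCurlOn hΩ hΩb hh hN hα hA φ hφ hφc hφs
    simp only [curl_add_density, smul_dotProduct, smul_eq_mul, waveNumber_sq hε hμ,
      magneticField] at hw ⊢
    have h1 (x : E3) : (Complex.I * ω * limitPermeability ω μ c₀ h N x)⁻¹ *
        (curl E x ⬝ᵥ curl φ x) = (Complex.I * ω * μ)⁻¹ *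
          (mediumFactor ω μ c₀ h N x * (curl E x ⬝ᵥ curl φ x)) := by
      rw [limitPermeability, mul_inv, mul_inv, inv_div]
      ring
    simp only [h1]
    rw [integral_const_mul, hw, integral_const_mul, integral_const_mul, ← mul_assoc]
    congr 1
    field_simp
    linear_combination (ε : ℂ) * Complex.I_sq

/-- The extra smoothness makes `H` continuously differentiable, so Ampère's law is pointwise. In the
curl of `iω m H`, the term with `∇×H` gives `ω² ε m E`, and the term with `∇m` becomes the vector
product once `H` is expressed through `∇×E`. -/
theorem IsLimitingField.curl_curl_eq {ω ε μ c₀ : ℝ} (hω : 0 < ω) (hε : 0 < ε) (hμ : 0 < μ)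
    {Ω : Set E3} (hΩ : IsOpen Ω)
    (hΩb : Bornology.IsBounded Ω) {h : E3 → ℂ} (hh : ContinuousOn h Ω) {N : E3 → ℝ}
    (hN : ContinuousOn N Ω) (hd : ∀ x ∈ Ω, mediumFactor ω μ c₀ h N x ≠ 0)
    {α : E3} (hα : ‖α‖ = 1) {A : C3}
    (hA : (A ⬝ᵥ fun i => (α i : ℂ)) = 0) {E : E3 → C3}
    (hE : IsLimitingField ω ε μ c₀ Ω h N ((2 / 3 : ℝ) • (1 : Matrix (Fin 3) (Fin 3) ℝ))
      (planeWave (waveNumber ω ε μ) α A) E)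
    (hhN : ContDiffOn ℝ 1 (fun x => h x * N x) Ω) (hE2 : ContDiffOn ℝ 2 E Ω) {x : E3}
    (hx : x ∈ Ω) :
    curl (curl E) x = ((ω : ℂ) ^ 2 * ε * limitPermeability ω μ c₀ h N x) • E x +
      ((limitPermeability ω μ c₀ h N x)⁻¹ • cgrad (limitPermeability ω μ c₀ h N) x) ⨯₃
        curl E x := by
  have hω' : (ω : ℂ) ≠ 0 := by exact_mod_cast hω.ne'
  have hμ' : (μ : ℂ) ≠ 0 := by exact_mod_cast hμ.ne'
  have hM := hE.isMaxwellField hω hε hμ hΩ hΩb hh hN hd hα hA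
  set m := limitPermeability ω μ c₀ h N
  set H := magneticField ω m E
  have hm0 (x : E3) (hx : x ∈ Ω) : m x ≠ 0 := div_ne_zero hμ' (hd x hx)
  have hIm (x : E3) (hx : x ∈ Ω) : Complex.I * ω * m x ≠ 0 :=
    mul_ne_zero (mul_ne_zero Complex.I_ne_zero hω') (hm0 x hx)
  have hdc : ContDiffOn ℝ 1 (mediumFactor ω μ c₀ h N) Ω :=
    contDiffOn_const.add (contDiffOn_const.mul hhN)
  have hmc : ContDiffOn ℝ 1 m Ω :=
    (contDiffOn_const.mul (hdc.inv hd)).congr fun x _ => div_eq_mul_inv _ _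
  have hHc : ContDiffOn ℝ 1 H Ω :=
    ((contDiffOn_const.mul hmc).inv hIm).smul (hE2.curl hΩ (by norm_num))
  have hmx : DifferentiableAt ℝ m x :=
    (hmc.contDiffAt (hΩ.mem_nhds hx)).differentiableAt one_ne_zero
  have hHx : DifferentiableAt ℝ H x :=
    (hHc.contDiffAt (hΩ.mem_nhds hx)).differentiableAt one_ne_zero
  have hcH := hM.ampere.eqOn_curl hΩ hHc
    (hE.contDiffOn.continuousOn.const_smul (-(Complex.I * ω * ε))) hx
  have hev : curl E =ᶠ[𝓝 x] fun y => (Complex.I * ω * m y) • H y :=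
    Filter.eventuallyEq_of_mem (hΩ.mem_nhds hx) hM.faraday
  have hg : cgrad (fun y => Complex.I * ω * m y) x = (Complex.I * ω) • cgrad m x := by
    ext i
    simp only [cgrad]
    rw [fderiv_const_mul hmx]
    rfl
  rw [curl_congr_of_eventuallyEq hev, curl_smul (hmx.const_mul _) hHx, hcH, hg, hM.faraday x hx,
    add_comm, smul_smul]
  congr 1
  · congr 1
    linear_combination (-(ω : ℂ) ^ 2 * ε * m x) * Complex.I_sq
  · simp only [map_smul, LinearMap.smul_apply, smul_smul]
    congr 1
    field_simp [hm0 x hx]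

theorem theorem4p2 (ω ε μ c₀ : ℝ) (hω : 0 < ω) (hε : 0 < ε) (hμ : 0 < μ) (hc₀ : 0 < c₀)
    (Ω : Set E3) (hΩ : IsOpen Ω) (hΩb : Bornology.IsBounded Ω)
    (h : E3 → ℂ) (hh : ContinuousOn h Ω) (hhre : ∀ x ∈ Ω, 0 ≤ (h x).re)
    (N : E3 → ℝ) (hN : ContinuousOn N Ω) (hN0 : ∀ x ∈ Ω, 0 ≤ N x)
    -- the shape of the particles; its tensor is a multiple of the identity
    (D : Set E3) (ν : E3 → E3) (hD : IsParticle D ν)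
    (hτ : ∃ t : ℝ, shapeTensor D ν = t • (1 : Matrix (Fin 3) (Fin 3) ℝ))
    -- the formulas for `n(x)` and `μ(x)` make sense
    (hd : ∀ x ∈ Ω, mediumFactor ω μ c₀ h N x ≠ 0)
    -- `n = 1 / √(...)`, for any choice of the square root
    (s n : E3 → ℂ) (hs : ∀ x ∈ Ω, s x ^ 2 = mediumFactor ω μ c₀ h N x)
    (hn : ∀ x ∈ Ω, n x = 1 / s x) :
    -- the tensor is `(2/3) I`, and balls are particles of this kind
    shapeTensor D ν = (2 / 3 : ℝ) • (1 : Matrix (Fin 3) (Fin 3) ℝ) ∧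
    (∀ (c : E3) (r : ℝ), 0 < r →
      IsParticle (Metric.ball c r) (fun x => r⁻¹ • (x - c)) ∧
      shapeTensor (Metric.ball c r) (fun x => r⁻¹ • (x - c)) =
        (2 / 3 : ℝ) • (1 : Matrix (Fin 3) (Fin 3) ℝ)) ∧
    -- `n` is the refraction coefficient of a medium with permeability `μ(x)`: `k² n² = ω² ε μ(x)`
    (∀ x ∈ Ω, (waveNumber ω ε μ : ℂ) ^ 2 * n x ^ 2 =
      (ω : ℂ) ^ 2 * ε * limitPermeability ω μ c₀ h N x) ∧
    -- every limiting field is the electric field in the medium with these coefficients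
    (∀ (α : E3) (A : C3) (E : E3 → C3), ‖α‖ = 1 → (A ⬝ᵥ fun i => (α i : ℂ)) = 0 →
      IsLimitingField ω ε μ c₀ Ω h N (shapeTensor D ν)
        (planeWave (waveNumber ω ε μ) α A) E →
      (∃ H : E3 → C3, IsMaxwellField ω ε Ω (limitPermeability ω μ c₀ h N) E H) ∧
      (ContDiffOn ℝ 1 (fun x => h x * N x) Ω → ContDiffOn ℝ 2 E Ω →
        ∀ x ∈ Ω, curl (curl E) x =
          ((waveNumber ω ε μ : ℂ) ^ 2 * n x ^ 2) • E x +
            ((limitPermeability ω μ c₀ h N x)⁻¹ •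
              cgrad (limitPermeability ω μ c₀ h N) x) ⨯₃ curl E x)) := by
  have hτ' : shapeTensor D ν = (2 / 3 : ℝ) • (1 : Matrix (Fin 3) (Fin 3) ℝ) := by
    obtain ⟨t, ht⟩ := hτ
    exact hD.shapeTensor_eq_of_eq_smul_one ht
  have hkn (x : E3) (hx : x ∈ Ω) : (waveNumber ω ε μ : ℂ) ^ 2 * n x ^ 2 =
      (ω : ℂ) ^ 2 * ε * limitPermeability ω μ c₀ h N x := by
    rw [hn x hx, div_pow, hs x hx, waveNumber_sq hε hμ, limitPermeability]
    ring
  refine ⟨hτ', fun c r hr => ⟨isParticle_ball c hr, shapeTensor_ball c hr⟩, hkn,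
    fun α A E hα hA hE => ?_⟩
  rw [hτ'] at hE
  refine ⟨⟨_, hE.isMaxwellField hω hε hμ hΩ hΩb hh hN hd hα hA⟩, fun hhN hE2 x hx => ?_⟩
  rw [hkn x hx]
  exact hE.curl_curl_eq hω hε hμ hΩ hΩb hh hN hd hα hA hhN hE2 hx
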